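/- Let $\mathbb F$ be a field of prime characteristic $p$, let $L$ be a finite-dimensional abelian restricted Lie algebra over $\mathbb F$ (that is, a Lie algebra with a $[p]$-mapping $x\mapsto x^{[p]}$), and let $H$ be any restricted Lie algebra over $\mathbb F$. Let $u(L)=U(L)/(x^{[p]}-x^p : x\in L)$ and $u(H)$ denote the restricted enveloping algebras, and suppose that $u(L)\cong u(H)$ as associative unital $\mathbb F$-algebras. (1) If $\mathbb F$ is perfect and $L$ is $p$-nilpotent (there is a positive integer $k$ such that the $k$-fold iterate of the $[p]$-mapping vanishes on $L$), then $L\cong H$ as restricted Lie algebras. (2) If $\mathbb F$ is algebraically closed, then $L\cong H$ as restricted Lie algebras (with no $p$-nilpotence assumption). Here an isomorphism of restricted Lie algebras is an $\mathbb F$-linear bijection that preserves the Lie bracket and commutes with the $[p]$-mappings. -/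

import Mathlib

noncomputable section

universe u v w

/-- The element `s_i(x, y)` of a Lie algebra over a field of characteristic `p`, for
`1 ≤ i ≤ p - 1`: the one for which `i s_i(x, y)` is the coefficient of `t ^ (i - 1)` in
`ad (t x + y) ^ (p - 1) (x)`. The power is computed in the ring of polynomials in `t` over the
endomorphisms of `L`, and the coefficient is then applied to `x`.

Here `ad x` is Mathlib's `y ↦ ⁅x, y⁆`. With the other usual convention `y ↦ ⁅y, x⁆` every
`(p - 1)`-st power is multiplied by `(-1) ^ (p - 1)`, which is `1` in characteristic `p`, so
`s_i` is the same. -/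
def jacobsonTerm (F : Type u) {L : Type v} [Field F] [LieRing L] [LieAlgebra F L]
    (p i : ℕ) (x y : L) : L :=
  (i : F)⁻¹ •
    (((Polynomial.X * Polynomial.C (LieAlgebra.ad F L x : Module.End F L) +
        Polynomial.C (LieAlgebra.ad F L y : Module.End F L)) ^ (p - 1)).coeff (i - 1)) x

/-- A restricted Lie algebra over a field `F` (of prime characteristic `p`): a Lie algebra with
a `[p]`-mapping. (Replacing `ad` by the opposite convention `y ↦ ⁅y, x⁆` multiplies the two sides
of `ad_pow` by `(-1) ^ p` and `-1`, which agree in characteristic `p`.) -/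
class RestrictedLieAlgebra (F : Type u) (p : ℕ) (L : Type v) [Field F] [LieRing L]
    [LieAlgebra F L] where
  /-- The `[p]`-mapping. -/
  pMap : L → L
  ad_pow : ∀ x : L,
    (LieAlgebra.ad F L x : Module.End F L) ^ p = LieAlgebra.ad F L (pMap x)
  pMap_smul : ∀ (a : F) (x : L), pMap (a • x) = a ^ p • pMap x
  pMap_add : ∀ x y : L,
    pMap (x + y) = pMap x + pMap y + ∑ i ∈ Finset.Icc 1 (p - 1), jacobsonTerm F p i x y

namespace RestrictedLieAlgebra

variable (F : Type u) (p : ℕ) (L : Type v) [Field F] [LieRing L] [LieAlgebra F L]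
  [RestrictedLieAlgebra F p L]

/-- `L` is `p`-nilpotent if, for some positive `k`, the `k`-fold iterate of the `[p]`-mapping
vanishes on all of `L`. -/
def IsPNilpotent : Prop :=
  ∃ k : ℕ, 0 < k ∧ ∀ x : L, (pMap F p : L → L)^[k] x = 0

/-- The relations `x^{[p]} = x ^ p`, `x ∈ L`, on the universal enveloping algebra of `L`. -/
inductive EnvelopingRel :
    UniversalEnvelopingAlgebra F L → UniversalEnvelopingAlgebra F L → Prop
  | pMap_compat (x : L) :
      EnvelopingRel (UniversalEnvelopingAlgebra.ι F (pMap F p x))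
        (UniversalEnvelopingAlgebra.ι F x ^ p)

/-- The restricted universal enveloping algebra `u(L)`: the quotient of the universal enveloping
algebra of `L` by the two-sided ideal generated by all `x^{[p]} - x ^ p`, `x ∈ L`. -/
def Enveloping : Type (max u v) := RingQuot (EnvelopingRel F p L)

instance : Ring (Enveloping F p L) :=
  inferInstanceAs (Ring (RingQuot (EnvelopingRel F p L)))

instance : Algebra F (Enveloping F p L) :=
  inferInstanceAs (Algebra F (RingQuot (EnvelopingRel F p L)))

/-- An isomorphism of restricted Lie algebras: an isomorphism of Lie algebras that commutes with
the `[p]`-mappings. -/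
structure Iso (H : Type w) [LieRing H] [LieAlgebra F H] [RestrictedLieAlgebra F p H]
    extends L ≃ₗ⁅F⁆ H where
  map_pMap : ∀ x : L, toFun (pMap F p x) = pMap F p (toFun x)

end RestrictedLieAlgebra

end

/-! Commutativity of `u(H)` forces `H` to be abelian, and an abelian restricted Lie algebra is a
vector space with a `p`-semilinear endomorphism φ, its `[p]`-mapping. The pair is then recovered
from dimensions visible in the associative algebra.

`H` is abelian: it suffices that `H` embeds in `u(H)` (`ι_injective_of_comm`). The adjoint
representation factors through the commutative algebra `u(H)`, so `H` has class at most two. The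
bracket is then β(x, y) - β(y, x) for a bilinear β with central values that vanishes on the centre
in both arguments. Multiplication by x plus the derivation induced by β(x, ·) represents `H` on a
truncated polynomial algebra, where x is read off from the image of 1.

Invariants: the `p ^ i`-th powers in `u(L)` span the subalgebra generated by φ^i(L), which has a
basis of truncated monomials and hence dimension `p` to the power dim φ^i(L)
(`Enveloping.finrank_span_range_pow`). So `L` and `H` have the same numbers dim φ^i.

Classification (`exists_equiv_of_finrank_imageSeq`): an isomorphism between the images of φ and ψ
extends to the whole spaces, which allows induction on dimension down to the surjective case. There
a nilpotent φ lives on the zero space, and over an algebraically closed field Lang's theorem gives a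
basis of fixed vectors, so the dimension decides. -/

/-! ### Truncated polynomial algebras -/

namespace TruncatedPolynomial

open MvPolynomial Finsupp

variable {F : Type*} [Field F] {σ : Type*}

/-- The normal form of the monomial `m` modulo the relations `X i ^ p = ∑ k, c i k • X k`. -/
noncomputable def normalForm (p : ℕ) (c : σ → σ →₀ F) (m : σ →₀ ℕ) : MvPolynomial σ F :=
  open Classical in
  if h : 2 ≤ p ∧ ∃ i, p ≤ m i then
    ∑ k ∈ (c h.2.choose).support,
      c h.2.choose k • normalForm p c (m - single h.2.choose p + single k 1)
  else monomial m 1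
termination_by m.degree
decreasing_by
  have h1 := h.2.choose_spec
  have h2 : m = (m - single h.2.choose p) + single h.2.choose p := by
    rw [tsub_add_cancel_of_le]
    simpa using h1
  have h3 := congrArg Finsupp.degree h2
  rw [map_add, degree_single] at h3
  rw [map_add, degree_single]
  omega

variable {p : ℕ} {c : σ → σ →₀ F}

theorem normalForm_of_lt {m : σ →₀ ℕ} (hm : ∀ i, m i < p) :
    normalForm p c m = monomial m 1 := by
  rw [normalForm, dif_neg]
  rintro ⟨-, i, hi⟩
  exact absurd (hm i) (by omega)

/-- Confluence: `normalForm` rewrites at an arbitrarily chosen index, and the choice must not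
matter. Rewritings at two different indices act on disjoint factors and so commute; each lowers the
degree because `2 ≤ p`, whence the induction. -/
theorem normalForm_add_single (hp : 2 ≤ p) (m : σ →₀ ℕ) (i : σ) :
    normalForm p c (m + single i p) =
      ∑ k ∈ (c i).support, c i k • normalForm p c (m + single k 1) := by
  classical
  induction hd : m.degree using Nat.strong_induction_on generalizing m i with
  | _ d ih =>
    subst hd
    have h : 2 ≤ p ∧ ∃ j, p ≤ (m + single i p) j := ⟨hp, i, by simp⟩
    rw [normalForm, dif_pos h]
    generalize hj : h.2.choose = j
    have hjs : p ≤ (m + single i p) j := hj ▸ h.2.choose_spec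
    rcases eq_or_ne j i with rfl | hne
    · simp
    · have hm : p ≤ m j := by simpa [hne.symm] using hjs
      obtain ⟨m', rfl⟩ : ∃ m', m = m' + single j p :=
        ⟨m - single j p, by rw [tsub_add_cancel_of_le]; simpa using hm⟩
      have e1 : ∀ k, m' + single j p + single i p - single j p + single k 1 =
          m' + single k 1 + single i p := by
        intro k
        rw [add_right_comm m', add_tsub_cancel_right, add_right_comm]
      have e2 : ∀ k, m' + single j p + single k 1 = m' + single k 1 + single j p :=
        fun k => add_right_comm _ _ _
      have hlt : ∀ k, (m' + single k 1).degree < (m' + single j p).degree := by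
        intro k
        simp only [map_add, degree_single]
        omega
      simp only [e1, e2]
      rw [Finset.sum_congr rfl fun k _ => by rw [ih _ (hlt k) (m' + single k 1) i rfl],
        Finset.sum_congr (s₁ := (c i).support) rfl fun k _ => by
          rw [ih _ (hlt k) (m' + single k 1) j rfl]]
      simp only [Finset.smul_sum]
      rw [Finset.sum_comm]
      refine Finset.sum_congr rfl fun k _ => Finset.sum_congr rfl fun l _ => ?_
      rw [smul_comm, add_right_comm]

/-- The linear extension of `normalForm` to all polynomials. -/
noncomputable def reduce (p : ℕ) (c : σ → σ →₀ F) : MvPolynomial σ F →ₗ[F] MvPolynomial σ F :=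
  (MvPolynomial.basisMonomials σ F).constr F (normalForm p c)

theorem reduce_monomial (m : σ →₀ ℕ) : reduce p c (monomial m 1) = normalForm p c m := by
  have := (MvPolynomial.basisMonomials σ F).constr_basis F (normalForm p c) m
  rwa [coe_basisMonomials] at this

variable (F) in
/-- The linear form with the given coefficients. -/
noncomputable def linearForm (σ : Type*) : (σ →₀ F) →ₗ[F] MvPolynomial σ F :=
  Finsupp.linearCombination F X

@[simp]
theorem linearForm_single (i : σ) (a : F) : linearForm F σ (single i a) = a • X i := by
  simp [linearForm]

/-- The ideal generated by the polynomials `X i ^ p - ∑ k, c i k • X k`. -/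
noncomputable def relIdeal (p : ℕ) (c : σ → σ →₀ F) : Ideal (MvPolynomial σ F) :=
  Ideal.span (Set.range fun i => X i ^ p - linearForm F σ (c i))

theorem reduce_mul_rel (hp : 2 ≤ p) (q : MvPolynomial σ F) (i : σ) :
    reduce p c (q * (X i ^ p - linearForm F σ (c i))) = 0 := by
  induction q using MvPolynomial.induction_on' with
  | add q r hq hr => rw [add_mul, map_add, hq, hr, add_zero]
  | monomial m a =>
    have h1 : (monomial m a : MvPolynomial σ F) = a • monomial m 1 := by simp [smul_monomial]
    rw [h1, smul_mul_assoc, map_smul, mul_sub, map_sub, sub_eq_zero.2, smul_zero]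
    rw [X_pow_eq_monomial, monomial_mul, mul_one, reduce_monomial, normalForm_add_single hp,
      linearForm, Finsupp.linearCombination_apply, Finsupp.sum, Finset.mul_sum, map_sum]
    refine Finset.sum_congr rfl fun k _ => ?_
    rw [mul_smul_comm, map_smul, X, monomial_mul, mul_one, reduce_monomial]

theorem reduce_eq_zero (hp : 2 ≤ p) {q : MvPolynomial σ F} (hq : q ∈ relIdeal p c) :
    reduce p c q = 0 := by
  induction hq using Submodule.span_induction with
  | mem x hx =>
    obtain ⟨i, rfl⟩ := hx
    simpa using reduce_mul_rel hp (1 : MvPolynomial σ F) i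
  | zero => simp
  | add x y _ _ hx hy => rw [map_add, hx, hy, add_zero]
  | smul a x hx hx0 =>
    -- Vanishing at `x` says nothing about its multiples, so a second induction on `x` carries the
    -- multiplier `a` along.
    clear hx0
    induction hx using Submodule.span_induction generalizing a with
    | mem x hx =>
      obtain ⟨i, rfl⟩ := hx
      exact reduce_mul_rel hp a i
    | zero => simp
    | add x y _ _ hx hy => rw [smul_add, map_add, hx, hy, add_zero]
    | smul b x _ hx => rw [smul_smul]; exact hx _

theorem reduce_linearForm (hp : 2 ≤ p) (v : σ →₀ F) :
    reduce p c (linearForm F σ v) = linearForm F σ v := by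
  classical
  rw [linearForm, Finsupp.linearCombination_apply, Finsupp.sum, map_sum]
  refine Finset.sum_congr rfl fun i _ => ?_
  rw [map_smul, X, reduce_monomial, normalForm_of_lt]
  intro j
  rw [single_apply]
  split_ifs <;> omega

theorem linearForm_injective : Function.Injective (linearForm F σ) := by
  have : LinearIndependent F (X : σ → MvPolynomial σ F) := by
    have h := (MvPolynomial.basisMonomials σ F).linearIndependent.comp
      (fun i : σ => single i 1) (Finsupp.single_left_injective one_ne_zero)
    rw [coe_basisMonomials] at h
    exact h
  exact this

/-- Linear forms embed into the quotient by `relIdeal`. -/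
theorem eq_zero_of_linearForm_mem (hp : 2 ≤ p) {v : σ →₀ F}
    (hv : linearForm F σ v ∈ relIdeal p c) : v = 0 := by
  have := reduce_eq_zero hp hv
  rw [reduce_linearForm hp] at this
  exact linearForm_injective (by rw [this, map_zero])

/-- The truncated monomials are linearly independent in the quotient by `relIdeal`. -/
theorem linearIndependent_mk_monomial (hp : 2 ≤ p) {τ : Type*} (e : τ → σ →₀ ℕ)
    (he : Function.Injective e) (hlt : ∀ t i, e t i < p) :
    LinearIndependent F
      fun t => Ideal.Quotient.mk (relIdeal p c) (monomial (e t) (1 : F)) := by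
  let R : (MvPolynomial σ F ⧸ relIdeal p c) →ₗ[F] MvPolynomial σ F :=
    ((relIdeal p c).restrictScalars F).liftQ (reduce p c) fun q hq => reduce_eq_zero hp hq
  have hR : ∀ q, R (Ideal.Quotient.mk (relIdeal p c) q) = reduce p c q := fun q => rfl
  apply LinearIndependent.of_comp R
  have : R ∘ (fun t => Ideal.Quotient.mk (relIdeal p c) (monomial (e t) (1 : F))) =
      (MvPolynomial.basisMonomials σ F) ∘ e := by
    funext t
    simp only [Function.comp, hR, coe_basisMonomials, reduce_monomial]
    exact normalForm_of_lt (hlt t)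
  rw [this]
  exact (MvPolynomial.basisMonomials σ F).linearIndependent.comp e he

variable [Fact p.Prime] [CharP F p]

/-- If the relations come from a `p`-semilinear map, they hold for all linear forms. -/
theorem linearForm_pow_sub_mem {V : Type*} [AddCommGroup V] [Module F V] (b : Module.Basis σ F V)
    (ψ : V →ₛₗ[frobenius F p] V) (v : V) :
    linearForm F σ (b.repr v) ^ p - linearForm F σ (b.repr (ψ v)) ∈
      relIdeal p fun i => b.repr (ψ (b i)) := by
  induction b.mem_span v using Submodule.span_induction with
  | mem x hx =>
    obtain ⟨i, rfl⟩ := hx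
    rw [b.repr_self, linearForm_single, one_smul]
    exact Ideal.subset_span ⟨i, rfl⟩
  | zero => simp [(Fact.out : p.Prime).ne_zero]
  | add v w _ _ hv hw =>
    rw [map_add, map_add, map_add, map_add, map_add, add_pow_char, add_sub_add_comm]
    exact add_mem hv hw
  | smul a v _ hv =>
    rw [map_smulₛₗ ψ, map_smul, map_smul, map_smul, map_smul, smul_pow, frobenius_def, ← smul_sub]
    exact Submodule.smul_of_tower_mem _ _ hv

end TruncatedPolynomial

/-! ### Powers of a sum with central commutator -/

section CentralCommutator

open Polynomial

variable {R : Type*} [Ring R]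

theorem pow_mul_eq_of_central_commutator {a b c : R} (h : b * a = a * b + c) (hb : Commute b c)
    (n : ℕ) : b ^ n * a = a * b ^ n + n • (c * b ^ (n - 1)) := by
  induction n with
  | zero => simp
  | succ n ih =>
    have hc : c * b ^ (n - 1) * b = c * b ^ n ∨ n = 0 := by
      rcases n with _ | n
      · exact Or.inr rfl
      · left; rw [Nat.add_sub_cancel, mul_assoc, ← pow_succ]
    have hbn : b ^ n * c = c * b ^ n := (hb.pow_left n).eq
    rw [pow_succ, mul_assoc, h, mul_add, ← mul_assoc, ih, add_mul, hbn, Nat.add_sub_cancel,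
      succ_nsmul, smul_mul_assoc, mul_assoc a]
    rcases hc with hc | rfl
    · rw [hc]; abel
    · simp

/-- The product rule inserts `C a` among the factors of a power. Moving it to the front past `j`
factors costs `j` copies of `c`, and 0 + 1 + ... + (n - 1) is the binomial coefficient. -/
theorem derivative_pow_of_central_commutator {a b c : R} (h : b * a = a * b + c)
    (ha : Commute a c) (hb : Commute b c) (n : ℕ) :
    derivative ((X * C a + C b) ^ n) =
      n • (C a * (X * C a + C b) ^ (n - 1)) + n.choose 2 • (C c * (X * C a + C b) ^ (n - 2)) := by
  set Q : R[X] := X * C a + C b with hQ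
  have hQa : Q * C a = C a * Q + C c := by
    rw [hQ, add_mul, mul_add, ← C_mul, h, C_add, C_mul, mul_assoc, ← mul_assoc (C a) X,
      ← X_mul_C, mul_assoc]
    abel
  have hQc : Commute Q (C c) := by
    rw [hQ]
    have hX : Commute X (C c) := X_mul_C c
    exact (hX.mul_left (ha.map C)).add_left (hb.map C)
  have hQ' : derivative Q = C a := by simp [hQ]
  induction n with
  | zero => simp
  | succ n ih =>
    rw [pow_succ, derivative_mul, ih, hQ', pow_mul_eq_of_central_commutator hQa hQc,
      Nat.add_sub_cancel, Nat.choose_succ_succ' n 1, Nat.choose_one_right, add_mul,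
      smul_mul_assoc, smul_mul_assoc, mul_assoc, mul_assoc, ← pow_succ, ← pow_succ, add_smul,
      succ_nsmul]
    rcases n with _ | _ | n
    · simp
    · simp
      abel
    · simp only [Nat.add_sub_cancel, show n + 1 + 1 + 1 - 2 = n + 1 by omega,
        show n + 1 + 1 - 2 + 1 = n + 1 by omega]
      generalize (n + 1 + 1).choose 2 = N
      generalize n + 1 + 1 = M
      simp only [add_smul]
      abel

/-- In characteristic `p`, if `a` and `b` commute with their commutator `c = b * a - a * b`, then
`(a + b) ^ p = a ^ p + b ^ p`, up to the term `c` if `p = 2`. -/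
theorem add_pow_char_of_central_commutator (F : Type*) [Field F] (p : ℕ) [Fact p.Prime]
    [CharP F p] [Algebra F R] {a b c : R} (h : b * a = a * b + c)
    (ha : Commute a c) (hb : Commute b c) :
    (a + b) ^ p = a ^ p + b ^ p + if p = 2 then c else 0 := by
  have hpr : p.Prime := Fact.out
  have hz : ∀ x : R, p • x = 0 := fun x => by
    rw [← Nat.cast_smul_eq_nsmul F, CharP.cast_eq_zero, zero_smul]
  split_ifs with hp2
  · subst hp2
    have h2 : (2 : ℕ) • (a * b) = 0 := hz _
    have h3 : (a + b) ^ 2 = a ^ 2 + b ^ 2 + c + (2 : ℕ) • (a * b) := by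
      rw [sq, add_mul, mul_add, mul_add, h, sq, sq, two_nsmul]; abel
    rw [h3, h2, add_zero]
  · rw [add_zero]
    set Q : R[X] := X * C a + C b with hQ
    -- For odd `p` both `p` and `p.choose 2` vanish in the ring, so `Q ^ p` has no coefficients
    -- strictly between degrees 0 and `p`.
    have hd : derivative (Q ^ p) = 0 := by
      rw [hQ, derivative_pow_of_central_commutator h ha hb]
      obtain ⟨k, hk⟩ : p ∣ p.choose 2 :=
        hpr.dvd_choose_self two_ne_zero (lt_of_le_of_ne hpr.two_le (Ne.symm hp2))
      have hz' : ∀ q : R[X], p • q = 0 := fun q => by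
        ext n; rw [coeff_smul, hz, coeff_zero]
      rw [hz', hk, mul_smul, hz', add_zero]
    have hdeg : Q.natDegree ≤ 1 := by
      rw [hQ, X_mul_C]; exact natDegree_linear_le
    have hQp : Q ^ p = C (b ^ p) + X ^ p * C (a ^ p) := by
      ext n
      rw [coeff_add, coeff_X_pow_mul', coeff_C]
      rcases Nat.eq_zero_or_pos n with rfl | hn
      · rw [if_pos rfl, if_neg (by have := hpr.pos; omega), add_zero]
        have : constantCoeff (Q ^ p) = b ^ p := by rw [map_pow]; simp [hQ]
        exact this
      · rw [if_neg hn.ne', zero_add]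
        rcases lt_trichotomy n p with hlt | rfl | hgt
        · rw [if_neg (by omega)]
          obtain ⟨m, rfl⟩ : ∃ m, n = m + 1 := ⟨n - 1, by omega⟩
          have h0 := congrArg (fun q => coeff q m) hd
          simp only [coeff_derivative, coeff_zero] at h0
          have hne : ((m + 1 : ℕ) : F) ≠ 0 := by
            rw [Ne, CharP.cast_eq_zero_iff F p]
            exact fun hdvd => absurd (Nat.le_of_dvd (by omega) hdvd) (by omega)
          have h1 : ((m + 1 : ℕ) : F) • (Q ^ p).coeff (m + 1) = 0 := by
            rw [Nat.cast_smul_eq_nsmul, nsmul_eq_mul, (Nat.cast_commute _ _).eq, Nat.cast_add,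
              Nat.cast_one, h0]
          exact (smul_eq_zero.1 h1).resolve_left hne
        · rw [if_pos le_rfl, Nat.sub_self, coeff_C_zero]
          have := coeff_pow_of_natDegree_le (m := n) hdeg
          rw [mul_one] at this
          rw [this]
          simp [hQ, coeff_C]
        · rw [if_pos hgt.le, coeff_C, if_neg (by omega)]
          exact coeff_eq_zero_of_natDegree_lt
            (lt_of_le_of_lt (natDegree_pow_le_of_le p hdeg) (by omega))
    -- Evaluation at 1 is multiplicative even over a noncommutative ring, since 1 is central.
    let e : R[X] →+* R := eval₂RingHom' (RingHom.id R) 1 fun _ => Commute.one_right _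
    have heX : e X = 1 := by simp [e, eval₂RingHom']
    have heC : ∀ r, e (C r) = r := fun r => by simp [e, eval₂RingHom']
    have he := congrArg e hQp
    simp only [hQ, map_pow, map_add, map_mul, heX, heC, one_pow, one_mul] at he
    rw [he, add_comm]

end CentralCommutator

/-! ### The restricted enveloping algebra -/

namespace RestrictedLieAlgebra

attribute [local instance] LieRing.ofAssociativeRing

namespace Enveloping

variable (F : Type*) (p : ℕ) (L : Type*) [Field F] [LieRing L] [LieAlgebra F L]
  [RestrictedLieAlgebra F p L]

/-- The quotient map from the universal enveloping algebra. -/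
noncomputable def mk : UniversalEnvelopingAlgebra F L →ₐ[F] Enveloping F p L :=
  RingQuot.mkAlgHom F (EnvelopingRel F p L)

/-- The canonical map from a restricted Lie algebra to its restricted enveloping algebra. -/
noncomputable def ι : L →ₗ⁅F⁆ Enveloping F p L :=
  ((mk F p L : UniversalEnvelopingAlgebra F L →ₐ[F] Enveloping F p L) :
    UniversalEnvelopingAlgebra F L →ₗ⁅F⁆ Enveloping F p L).comp (UniversalEnvelopingAlgebra.ι F)

variable {F p L}

theorem ι_eq_mk (x : L) : ι F p L x = mk F p L (UniversalEnvelopingAlgebra.ι F x) := rfl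

theorem ι_pMap (x : L) : ι F p L (pMap F p x) = ι F p L x ^ p := by
  rw [ι_eq_mk, ι_eq_mk, ← map_pow]
  exact RingQuot.mkAlgHom_rel F (EnvelopingRel.pMap_compat x)

theorem ι_lie (x y : L) : ι F p L ⁅x, y⁆ = ι F p L x * ι F p L y - ι F p L y * ι F p L x := by
  rw [LieHom.map_lie, Ring.lie_def]

variable {A : Type*} [Ring A] [Algebra F A]

/-- The universal property of the restricted enveloping algebra. -/
noncomputable def lift (f : L →ₗ⁅F⁆ A) (hf : ∀ x, f (pMap F p x) = f x ^ p) :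
    Enveloping F p L →ₐ[F] A :=
  RingQuot.liftAlgHom F (s := EnvelopingRel F p L) ⟨UniversalEnvelopingAlgebra.lift F f, by
    rintro _ _ ⟨x⟩
    rw [map_pow, UniversalEnvelopingAlgebra.lift_ι_apply, UniversalEnvelopingAlgebra.lift_ι_apply,
      hf]⟩

@[simp]
theorem lift_ι (f : L →ₗ⁅F⁆ A) (hf : ∀ x, f (pMap F p x) = f x ^ p) (x : L) :
    lift f hf (ι F p L x) = f x := by
  refine (RingQuot.liftAlgHom_mkAlgHom_apply F _ _ _).trans ?_
  exact UniversalEnvelopingAlgebra.lift_ι_apply F f x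

theorem algHom_ext {f g : Enveloping F p L →ₐ[F] A} (h : ∀ x, f (ι F p L x) = g (ι F p L x)) :
    f = g := by
  have h1 : f.comp (mk F p L) = g.comp (mk F p L) :=
    UniversalEnvelopingAlgebra.hom_ext F (LieHom.ext h)
  exact RingQuot.ringQuot_ext' F _ _ h1

-- By the universal property the algebra maps to the subalgebra generated by the image of `L`;
-- followed by the inclusion, this is the identity.
variable (F p L) in
theorem adjoin_range_ι : Algebra.adjoin F (Set.range (ι F p L)) = ⊤ := by
  set S := Algebra.adjoin F (Set.range (ι F p L)) with hS
  have hmem : ∀ x, ι F p L x ∈ S := fun x => Algebra.subset_adjoin ⟨x, rfl⟩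
  let f : L →ₗ⁅F⁆ S :=
    { toFun := fun x => ⟨ι F p L x, hmem x⟩
      map_add' := fun x y => Subtype.ext (by simp)
      map_smul' := fun a x => Subtype.ext (by simp)
      map_lie' := fun {x y} => Subtype.ext (ι_lie x y) }
  have hf : ∀ x, f (pMap F p x) = f x ^ p := fun x => Subtype.ext (ι_pMap x)
  have h : S.val.comp (lift f hf) = AlgHom.id F _ := algHom_ext fun x => by
    rw [AlgHom.comp_apply, lift_ι]; rfl
  rw [eq_top_iff]
  intro x _
  have := congrArg (fun g => g x) h
  simp only [AlgHom.comp_apply, AlgHom.id_apply] at this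
  rw [← this]
  exact (lift f hf x).2

/-- A restricted Lie algebra with commutative restricted enveloping algebra has nilpotency class
at most two. -/
theorem lie_lie_eq_zero (hcomm : ∀ a b : Enveloping F p L, a * b = b * a) (x y z : L) :
    ⁅⁅x, y⁆, z⁆ = 0 := by
  -- The axiom `ad_pow` is what lets `ad` extend to the enveloping algebra, where the image of a
  -- bracket is zero by commutativity.
  have h := lift_ι (p := p) (LieAlgebra.ad F L) (fun x => (ad_pow x).symm) ⁅x, y⁆
  rw [ι_lie, hcomm, sub_self, map_zero] at h
  rw [← LieAlgebra.ad_apply F L, ← h]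
  rfl

end Enveloping

/-! ### Class two -/

section ClassTwo

variable {F : Type*} {p : ℕ} {L : Type*} [Field F] [LieRing L] [LieAlgebra F L]

/-- In class two any product of two `ad`s is zero, so the linear polynomial being raised to the
power `p - 1 ≥ 2` squares to zero. -/
theorem jacobsonTerm_of_lie_lie_eq_zero (hL : ∀ x y z : L, ⁅⁅x, y⁆, z⁆ = 0) (hp : 2 < p)
    (i : ℕ) (x y : L) : jacobsonTerm F p i x y = 0 := by
  have h2 : ∀ a b : L,
      (LieAlgebra.ad F L a : Module.End F L) * (LieAlgebra.ad F L b : Module.End F L) = 0 := by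
    intro a b
    ext z
    rw [Module.End.mul_apply, LieAlgebra.ad_apply, LieAlgebra.ad_apply, ← lie_skew, hL, neg_zero]
    rfl
  rw [jacobsonTerm]
  obtain ⟨n, rfl⟩ : ∃ n, p = n + 3 := ⟨p - 3, by omega⟩
  have h3 : ∀ a b : Module.End F L, a * a = 0 → a * b = 0 → b * a = 0 → b * b = 0 →
      (Polynomial.X * Polynomial.C a + Polynomial.C b) ^ 2 = 0 := by
    intro a b haa hab hba hbb
    have e1 : Polynomial.X * Polynomial.C a * (Polynomial.X * Polynomial.C a) =
        Polynomial.X * Polynomial.X * (Polynomial.C a * Polynomial.C a) := by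
      rw [mul_assoc, ← mul_assoc (Polynomial.C a), ← Polynomial.X_mul_C, mul_assoc, mul_assoc]
    have e2 : Polynomial.C b * (Polynomial.X * Polynomial.C a) =
        Polynomial.X * (Polynomial.C b * Polynomial.C a) := by
      rw [← mul_assoc, ← Polynomial.X_mul_C, mul_assoc]
    rw [sq, add_mul, mul_add, mul_add, e1, e2,
      mul_assoc _ (Polynomial.C a) (Polynomial.C b), ← Polynomial.C_mul, ← Polynomial.C_mul,
      ← Polynomial.C_mul, ← Polynomial.C_mul, haa, hab, hba, hbb]
    simp
  rw [show n + 3 - 1 = 2 + n by omega, pow_add, h3 _ _ (h2 x x) (h2 x y) (h2 y x) (h2 y y), zero_mul]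
  simp

theorem jacobsonTerm_two (x y : L) : jacobsonTerm F 2 1 x y = ⁅y, x⁆ := by
  simp [jacobsonTerm]

variable [RestrictedLieAlgebra F p L] [Fact p.Prime]

theorem pMap_add_of_lie_lie_eq_zero (hL : ∀ x y z : L, ⁅⁅x, y⁆, z⁆ = 0) (x y : L) :
    pMap F p (x + y) = pMap F p x + pMap F p y + if p = 2 then ⁅y, x⁆ else 0 := by
  rw [pMap_add]
  congr 1
  split_ifs with h
  · subst h
    simp [jacobsonTerm_two]
  · have := (Fact.out : p.Prime).two_le
    exact Finset.sum_eq_zero fun i _ => jacobsonTerm_of_lie_lie_eq_zero hL (by omega) i x y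

theorem lie_pMap_of_lie_lie_eq_zero (hL : ∀ x y z : L, ⁅⁅x, y⁆, z⁆ = 0) (x y : L) :
    ⁅pMap F p x, y⁆ = 0 := by
  rw [← LieAlgebra.ad_apply F L, ← ad_pow]
  obtain ⟨n, rfl⟩ : ∃ n, p = n + 2 :=
    ⟨p - 2, by have := (Fact.out : p.Prime).two_le; omega⟩
  rw [pow_add, Module.End.mul_apply, sq, Module.End.mul_apply, LieAlgebra.ad_apply,
    LieAlgebra.ad_apply, ← lie_skew, hL, neg_zero, map_zero]

end ClassTwo

end RestrictedLieAlgebra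

/-! ### A faithful representation in class two -/

section Derivation

open MvPolynomial

variable {F : Type*} [Field F] {σ : Type*}

/-- As `D` kills `D (X i)`, the iterated Leibniz rule for `X i * q` stops after two terms. In `D ^
p` the second carries the factor `p`, so `D ^ p` commutes with multiplication by variables; it also
kills constants. -/
theorem Derivation.pow_char_eq_zero (p : ℕ) [Fact p.Prime] [CharP F p]
    (D : Derivation F (MvPolynomial σ F) (MvPolynomial σ F)) (hD : ∀ i, D (D (X i)) = 0) :
    (D : MvPolynomial σ F →ₗ[F] MvPolynomial σ F) ^ p = 0 := by
  set T : Module.End F (MvPolynomial σ F) :=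
    (D : MvPolynomial σ F →ₗ[F] MvPolynomial σ F) with hT
  have hTD : ∀ q, T q = D q := fun _ => rfl
  have hT1 : ∀ n q, D ((T ^ n) q) = (T ^ (n + 1)) q := fun n q => by
    rw [pow_succ', Module.End.mul_apply, hTD]
  have key : ∀ (i : σ) (q : MvPolynomial σ F) (n : ℕ),
      (T ^ (n + 1)) (X i * q) = X i * (T ^ (n + 1)) q + (n + 1) • (D (X i) * (T ^ n) q) := by
    intro i q n
    induction n with
    | zero => simp [hTD, add_comm, mul_comm]
    | succ n ih =>
      rw [pow_succ', Module.End.mul_apply, ih, hTD, map_add, map_nsmul, Derivation.leibniz,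
        Derivation.leibniz, hD, hT1, hT1, ← pow_succ']
      simp only [smul_eq_mul, nsmul_eq_mul]
      push_cast
      ring
  obtain ⟨n, rfl⟩ : ∃ n, p = n + 1 := ⟨p - 1, by have := (Fact.out : p.Prime).pos; omega⟩
  refine LinearMap.ext fun q => ?_
  rw [LinearMap.zero_apply]
  induction q using MvPolynomial.induction_on with
  | C a => rw [pow_succ, Module.End.mul_apply, hTD, derivation_C, map_zero]
  | add q r hq hr => rw [map_add, hq, hr, add_zero]
  | mul_X q i hq =>
    rw [mul_comm, key, hq, mul_zero, zero_add, ← Nat.cast_smul_eq_nsmul F, CharP.cast_eq_zero,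
      zero_smul]

end Derivation

namespace RestrictedLieAlgebra

attribute [local instance] LieRing.ofAssociativeRing

open MvPolynomial TruncatedPolynomial

section Weyl

variable {F : Type*} {L : Type*} [Field F] [LieRing L] [LieAlgebra F L]
  {σ : Type*} (b : Module.Basis σ F L) (β : L →ₗ[F] L →ₗ[F] L)

/-- The linear form attached to an element of `L`. -/
noncomputable def form : L →ₗ[F] MvPolynomial σ F :=
  linearForm F σ ∘ₗ b.repr.toLinearMap

theorem form_basis (i : σ) : form b (b i) = X i := by
  simp [form]

/-- The derivation with constant-bracket coefficients `β x`. -/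
noncomputable def formDerivation (x : L) : Derivation F (MvPolynomial σ F) (MvPolynomial σ F) :=
  mkDerivation F fun i => form b (β x (b i))

theorem formDerivation_form (x y : L) : formDerivation b β x (form b y) = form b (β x y) := by
  have : (formDerivation b β x : MvPolynomial σ F →ₗ[F] MvPolynomial σ F) ∘ₗ form b =
      form b ∘ₗ β x := b.ext fun i => by
    simp only [LinearMap.comp_apply, form_basis]
    exact mkDerivation_X _ _ _
  exact LinearMap.congr_fun this y

theorem formDerivation_add (x y : L) :
    formDerivation b β (x + y) = formDerivation b β x + formDerivation b β y :=
  derivation_ext fun i => by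
    rw [Derivation.add_apply]
    simp only [formDerivation, mkDerivation_X, map_add, LinearMap.add_apply]

theorem formDerivation_smul (a : F) (x : L) :
    formDerivation b β (a • x) = a • formDerivation b β x :=
  derivation_ext fun i => by
    rw [Derivation.smul_apply]
    simp only [formDerivation, mkDerivation_X, map_smul, LinearMap.smul_apply]

theorem formDerivation_eq_zero {x : L} (hx : β x = 0) : formDerivation b β x = 0 :=
  derivation_ext fun i => by
    simp [formDerivation, mkDerivation_X, hx]

variable {β} in
theorem formDerivation_comm (hβ : ∀ x y z, β x (β y z) = 0) (x y : L) (q : MvPolynomial σ F) :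
    formDerivation b β x (formDerivation b β y q) =
      formDerivation b β y (formDerivation b β x q) := by
  have : ⁅formDerivation b β x, formDerivation b β y⁆ = 0 := derivation_ext fun i => by
    rw [Derivation.commutator_apply, ← form_basis b, formDerivation_form, formDerivation_form,
      formDerivation_form, formDerivation_form, hβ, hβ]
    simp
  have := congrArg (fun D => D q) this
  simp only [Derivation.commutator_apply, Derivation.zero_apply] at this
  exact sub_eq_zero.1 this

/-- Multiplication by a linear form plus the derivation. -/
noncomputable def weyl (x : L) : Module.End F (MvPolynomial σ F) :=
  LinearMap.mulLeft F (form b x) + formDerivation b β x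

theorem weyl_apply (x : L) (q : MvPolynomial σ F) :
    weyl b β x q = form b x * q + formDerivation b β x q := rfl

variable {β}

/-- Multiplications commute among themselves, and so do the derivations; only the cross terms
survive, giving multiplication by the form of `β x y - β y x`. -/
theorem weyl_lie (hβ : ∀ x y, β x y - β y x = ⁅x, y⁆) (hββ : ∀ x y z, β x (β y z) = 0)
    {x y : L} (hxy : β ⁅x, y⁆ = 0) (q : MvPolynomial σ F) :
    weyl b β ⁅x, y⁆ q = weyl b β x (weyl b β y q) - weyl b β y (weyl b β x q) := by
  rw [weyl_apply, formDerivation_eq_zero b β hxy, ← hβ]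
  simp only [weyl_apply, Derivation.zero_apply, map_add, Derivation.leibniz, formDerivation_form,
    formDerivation_comm b hββ x y, map_sub, smul_eq_mul]
  ring

/-- The two summands of `weyl` have central commutator, multiplication by the form of `β x x`, and
the `p`-th power of the derivation is zero. -/
theorem weyl_pow {p : ℕ} [Fact p.Prime] [CharP F p] (hββ : ∀ x y z, β x (β y z) = 0) (x : L)
    (q : MvPolynomial σ F) :
    (weyl b β x ^ p) q = form b x ^ p * q + if p = 2 then form b (β x x) * q else 0 := by
  set D : Module.End F (MvPolynomial σ F) :=
    (formDerivation b β x : MvPolynomial σ F →ₗ[F] MvPolynomial σ F) with hDdef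
  have hD : ∀ y q, D (form b y * q) = form b y * D q + q * form b (β x y) := fun y q =>
    ((formDerivation b β x).leibniz _ _).trans (by rw [formDerivation_form]; rfl)
  have h := add_pow_char_of_central_commutator F p (a := LinearMap.mulLeft F (form b x))
    (b := D) (c := LinearMap.mulLeft F (form b (β x x)))
    (LinearMap.ext fun q => by
      rw [LinearMap.add_apply, Module.End.mul_apply, Module.End.mul_apply,
        LinearMap.mulLeft_apply, LinearMap.mulLeft_apply, LinearMap.mulLeft_apply, hD,
        mul_comm q])
    (LinearMap.ext fun q => mul_left_comm _ _ _)
    (LinearMap.ext fun q => by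
      rw [Module.End.mul_apply, Module.End.mul_apply,
        LinearMap.mulLeft_apply, LinearMap.mulLeft_apply, hD, hββ, map_zero, mul_zero, add_zero])
  rw [hDdef, Derivation.pow_char_eq_zero p _ fun i => by
    rw [← form_basis b, formDerivation_form, formDerivation_form, hββ, map_zero], add_zero] at h
  rw [weyl, h, LinearMap.add_apply, LinearMap.pow_mulLeft]
  split_ifs <;> rfl

/-- The derivation kills each generator of the ideal: `p`-th powers by the characteristic, linear
parts by `hψ`. -/
theorem weyl_mem_relIdeal {p : ℕ} [Fact p.Prime] [CharP F p] {ψ : L → L}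
    (hψ : ∀ x y, β x (ψ y) = 0) (x : L) {q : MvPolynomial σ F}
    (hq : q ∈ relIdeal p fun i => b.repr (ψ (b i))) :
    weyl b β x q ∈ relIdeal p fun i => b.repr (ψ (b i)) := by
  rw [weyl_apply]
  refine add_mem (Ideal.mul_mem_left _ _ hq) ?_
  induction hq using Submodule.span_induction with
  | mem q hq =>
    obtain ⟨i, rfl⟩ := hq
    have h1 : formDerivation b β x (linearForm F σ (b.repr (ψ (b i)))) = 0 := by
      rw [show linearForm F σ (b.repr (ψ (b i))) = form b (ψ (b i)) from rfl,
        formDerivation_form, hψ, map_zero]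
    rw [map_sub, h1, Derivation.leibniz_pow, ← Nat.cast_smul_eq_nsmul F, CharP.cast_eq_zero,
      zero_smul, sub_zero]
    exact zero_mem _
  | zero => rw [map_zero]; exact zero_mem _
  | add q r _ _ hq hr => rw [map_add]; exact add_mem hq hr
  | smul a q hqI hq =>
    rw [smul_eq_mul, Derivation.leibniz]
    exact add_mem (Ideal.mul_mem_left _ _ hq) (Ideal.mul_mem_right _ _ hqI)

end Weyl

section Faithful

variable {F : Type*} {p : ℕ} {L : Type*} [Field F] [LieRing L] [LieAlgebra F L]
  [RestrictedLieAlgebra F p L] [Fact p.Prime] [CharP F p]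

/-- The `[p]`-mapping, twisted by the diagonal of `β` if `p = 2`. -/
noncomputable def twistedPMap (hL : ∀ x y z : L, ⁅⁅x, y⁆, z⁆ = 0) (β : L →ₗ[F] L →ₗ[F] L)
    (hβ : ∀ x y, β x y - β y x = ⁅x, y⁆) : L →ₛₗ[frobenius F p] L where
  toFun x := pMap F p x - if p = 2 then β x x else 0
  map_add' x y := by
    rw [pMap_add_of_lie_lie_eq_zero hL]
    split_ifs with h
    · subst h
      -- The bracket produced by `pMap (x + y)`, less the cross terms of `β`, leaves `-2 β x y`.
      have h2 : β x y + β x y = 0 := by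
        rw [← two_smul F, show (2 : F) = 0 from CharP.cast_eq_zero F 2, zero_smul]
      rw [← hβ, map_add, map_add, LinearMap.add_apply, LinearMap.add_apply,
        ← sub_eq_zero, ← neg_eq_zero, ← h2]
      abel
    · abel
  map_smul' a x := by
    rw [pMap_smul, frobenius_def]
    split_ifs with h
    · subst h
      rw [map_smul, LinearMap.map_smul, LinearMap.smul_apply, smul_smul, ← sq, smul_sub]
    · rw [sub_zero, sub_zero]

/-- The `weyl` operators act on the quotient by the relations of the twisted map `ψ`. The twist
cancels the extra term of `weyl_pow` at `p = 2`, so the action respects the `[p]`-mapping and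
factors through `u(L)`. Applied to 1, the operator of `x` gives the linear form of `x`, which
survives in the quotient. -/
theorem ι_injective_of_bilinear (hL : ∀ x y z : L, ⁅⁅x, y⁆, z⁆ = 0) (β : L →ₗ[F] L →ₗ[F] L)
    (hβ : ∀ x y, β x y - β y x = ⁅x, y⁆) (hβc : ∀ x y z : L, ⁅β x y, z⁆ = 0)
    (hβz : ∀ z, (∀ y : L, ⁅z, y⁆ = 0) → β z = 0 ∧ ∀ x, β x z = 0) :
    Function.Injective (Enveloping.ι F p L) := by
  let b := Module.Basis.ofVectorSpace F L
  have hββ : ∀ x y z, β x (β y z) = 0 := fun x y z => (hβz _ (hβc y z)).2 x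
  set ψ : L →ₛₗ[frobenius F p] L := twistedPMap hL β hβ with hψdef
  have hψ : ∀ x y, β x (ψ y) = 0 := by
    intro x y
    refine (hβz _ fun z => ?_).2 x
    rw [hψdef]
    simp only [twistedPMap, LinearMap.coe_mk, AddHom.coe_mk]
    rw [sub_lie, lie_pMap_of_lie_lie_eq_zero hL]
    split_ifs <;> simp [hβc]
  set I : Ideal (MvPolynomial _ F) := relIdeal p fun i => b.repr (ψ (b i)) with hI
  have hstab : ∀ x, I.restrictScalars F ≤ (I.restrictScalars F).comap (weyl b β x) :=
    fun x q hq => weyl_mem_relIdeal b hψ x hq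
  let ρ : L →ₗ⁅F⁆ Module.End F (MvPolynomial _ F ⧸ I.restrictScalars F) :=
    { toFun := fun x => (I.restrictScalars F).mapQ _ (weyl b β x) (hstab x)
      map_add' := fun x y => by
        refine Submodule.linearMap_qext _ (LinearMap.ext fun q => ?_)
        simp only [LinearMap.comp_apply, LinearMap.add_apply, Submodule.mkQ_apply,
          Submodule.mapQ_apply, ← Submodule.Quotient.mk_add]
        congr 1
        rw [weyl_apply, weyl_apply, weyl_apply, map_add, formDerivation_add,
          Derivation.add_apply]
        ring
      map_smul' := fun a x => by
        refine Submodule.linearMap_qext _ (LinearMap.ext fun q => ?_)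
        simp only [LinearMap.comp_apply, LinearMap.smul_apply, Submodule.mkQ_apply,
          Submodule.mapQ_apply, ← Submodule.Quotient.mk_smul, RingHom.id_apply]
        congr 1
        rw [weyl_apply, weyl_apply, map_smul, formDerivation_smul, Derivation.smul_apply,
          smul_add, smul_mul_assoc]
      map_lie' := fun {x y} => by
        refine Submodule.linearMap_qext _ (LinearMap.ext fun q => ?_)
        rw [Ring.lie_def]
        simp only [LinearMap.comp_apply, LinearMap.sub_apply, Submodule.mkQ_apply,
          Submodule.mapQ_apply, Module.End.mul_apply, ← Submodule.Quotient.mk_sub]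
        congr 1
        exact weyl_lie b hβ hββ (hβz _ fun z => hL x y z).1 q }
  have hρ : ∀ x q, ρ x (Submodule.Quotient.mk q) = Submodule.Quotient.mk (weyl b β x q) :=
    fun x q => rfl
  have hρp : ∀ x, ρ (pMap F p x) = ρ x ^ p := by
    intro x
    refine Submodule.linearMap_qext _ (LinearMap.ext fun q => ?_)
    have h1 : ρ x ^ p = (I.restrictScalars F).mapQ _ (weyl b β x ^ p)
        ((I.restrictScalars F).le_comap_pow_of_le_comap (hstab x) p) :=
      (Submodule.mapQ_pow _ (hstab x) p _).symm
    rw [h1]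
    simp only [LinearMap.comp_apply, Submodule.mkQ_apply, Submodule.mapQ_apply, hρ]
    refine ((Submodule.Quotient.eq _).2 ?_).symm
    rw [weyl_pow b hββ, weyl_apply, formDerivation_eq_zero b β
      (hβz _ fun z => lie_pMap_of_lie_lie_eq_zero hL x z).1, Derivation.zero_apply, add_zero]
    have h2 := linearForm_pow_sub_mem b ψ x
    have h3 : pMap F p x = ψ x + if p = 2 then β x x else 0 := (sub_add_cancel _ _).symm
    have h4 : form b (if p = 2 then β x x else 0) * q =
        if p = 2 then form b (β x x) * q else 0 := by split_ifs <;> simp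
    rw [h3, map_add, add_mul, h4, add_sub_add_right_eq_sub, ← sub_mul]
    exact Ideal.mul_mem_right _ _ h2
  rw [injective_iff_map_eq_zero]
  intro x hx
  have h1 := Enveloping.lift_ι ρ hρp x
  rw [hx, map_zero] at h1
  have h2 := LinearMap.congr_fun h1 (Submodule.Quotient.mk 1)
  rw [hρ, LinearMap.zero_apply, weyl_apply, Derivation.map_one_eq_zero, add_zero, mul_one] at h2
  have h3 := (Submodule.Quotient.mk_eq_zero _).1 h2.symm
  have h4 := eq_zero_of_linearForm_mem (Fact.out : p.Prime).two_le h3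
  simpa using h4

-- Half the bracket would do, but not in characteristic 2. Instead the strictly upper triangular
-- part of the bracket is taken in an arbitrarily ordered basis of the quotient by the centre; `s`
-- is a linear section of that quotient.
omit [RestrictedLieAlgebra F p L] [Fact p.Prime] [CharP F p] in
theorem exists_bilinear (hL : ∀ x y z : L, ⁅⁅x, y⁆, z⁆ = 0) :
    ∃ β : L →ₗ[F] L →ₗ[F] L, (∀ x y, β x y - β y x = ⁅x, y⁆) ∧ (∀ x y z : L, ⁅β x y, z⁆ = 0) ∧
      ∀ z, (∀ y : L, ⁅z, y⁆ = 0) → β z = 0 ∧ ∀ x, β x z = 0 := by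
  let Z : Submodule F L := LinearMap.ker (LieAlgebra.ad F L : L →ₗ[F] Module.End F L)
  have hZ : ∀ z, z ∈ Z ↔ ∀ y : L, ⁅z, y⁆ = 0 := fun z => by
    rw [LinearMap.mem_ker]
    exact LinearMap.ext_iff
  let b := Module.Basis.ofVectorSpace F (L ⧸ Z)
  obtain ⟨s, hs⟩ := Z.mkQ.exists_rightInverse_of_surjective Z.range_mkQ
  have hs' : ∀ x, Z.mkQ (s x) = x := fun x => LinearMap.congr_fun hs x
  classical
  let _ : LinearOrder (Module.Basis.ofVectorSpaceIndex F (L ⧸ Z)) := linearOrderOfSTO WellOrderingRel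
  let B : (L ⧸ Z) →ₗ[F] (L ⧸ Z) →ₗ[F] L := b.constr F fun i => b.constr F fun j =>
    if i < j then ⁅s (b i), s (b j)⁆ else 0
  have hBb : ∀ i j, B (b i) (b j) = if i < j then ⁅s (b i), s (b j)⁆ else 0 := by
    intro i j
    simp only [B, Module.Basis.constr_basis]
  let ω : (L ⧸ Z) →ₗ[F] (L ⧸ Z) →ₗ[F] L :=
    ((LieModule.toEnd F L L : L →ₗ[F] Module.End F L).compl₁₂ s s)
  have hω : ∀ x y, ω x y = ⁅s x, s y⁆ := fun x y => rfl
  have hBω : B - B.flip = ω := b.ext fun i => b.ext fun j => by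
    rw [LinearMap.sub_apply, LinearMap.sub_apply, LinearMap.flip_apply, hBb, hBb, hω]
    rcases lt_trichotomy i j with h | rfl | h
    · rw [if_pos h, if_neg h.asymm, sub_zero]
    · simp
    · rw [if_neg h.asymm, if_pos h, zero_sub, lie_skew]
  have hBc : ∀ (x y : L ⧸ Z) (z : L), ⁅B x y, z⁆ = 0 := by
    have h : B.compr₂ (LieAlgebra.ad F L : L →ₗ[F] Module.End F L) = 0 :=
      b.ext fun i => b.ext fun j => by
        ext z
        rw [LinearMap.compr₂_apply, hBb]
        split_ifs
        · exact hL _ _ z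
        · simp
    intro x y z
    exact LinearMap.congr_fun (LinearMap.congr_fun (LinearMap.congr_fun h x) y) z
  have hmk : ∀ x, s (Z.mkQ x) - x ∈ Z := fun x => by
    rw [← Submodule.Quotient.mk_eq_zero, ← Submodule.mkQ_apply, map_sub, hs', sub_self]
  have hlie : ∀ x y, ⁅s (Z.mkQ x), s (Z.mkQ y)⁆ = ⁅x, y⁆ := by
    intro x y
    have h1 := (hZ _).1 (hmk x) (s (Z.mkQ y))
    have h2 := (hZ _).1 (hmk y) x
    rw [sub_lie, sub_eq_zero] at h1 h2
    rw [h1, ← lie_skew, h2, lie_skew]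
  refine ⟨B.compl₁₂ Z.mkQ Z.mkQ, fun x y => ?_, fun x y z => hBc _ _ z, fun z hz => ?_⟩
  · have := LinearMap.congr_fun (LinearMap.congr_fun hBω (Z.mkQ x)) (Z.mkQ y)
    rw [hω, hlie] at this
    exact this
  · have h0 : Z.mkQ z = 0 := (Submodule.Quotient.mk_eq_zero _).2 ((hZ z).2 hz)
    constructor
    · ext y
      simp only [LinearMap.compl₁₂_apply, h0, map_zero, LinearMap.zero_apply]
    · intro x
      rw [LinearMap.compl₁₂_apply, h0, map_zero]

/-- A restricted Lie algebra with commutative restricted enveloping algebra embeds into it. -/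
theorem ι_injective_of_comm (hcomm : ∀ a b : Enveloping F p L, a * b = b * a) :
    Function.Injective (Enveloping.ι F p L) := by
  obtain ⟨β, h1, h2, h3⟩ := exists_bilinear (F := F) (Enveloping.lie_lie_eq_zero hcomm)
  exact ι_injective_of_bilinear (Enveloping.lie_lie_eq_zero hcomm) β h1 h2 h3

theorem lie_eq_zero_of_comm (hcomm : ∀ a b : Enveloping F p L, a * b = b * a) (x y : L) :
    ⁅x, y⁆ = 0 := by
  apply ι_injective_of_comm (F := F) (p := p) hcomm
  rw [Enveloping.ι_lie, hcomm, sub_self, map_zero]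

end Faithful

end RestrictedLieAlgebra

/-! ### Iterated images of semilinear maps -/

section ImageSeq

variable {F : Type*} [Field F] {s : F →+* F} [RingHomSurjective s] {V : Type*} [AddCommGroup V]
  [Module F V]

/-- The image of the `i`-fold iterate of a semilinear map. -/
def imageSeq (φ : V →ₛₗ[s] V) (i : ℕ) : Submodule F V := (Submodule.map φ)^[i] ⊤

theorem imageSeq_zero (φ : V →ₛₗ[s] V) : imageSeq φ 0 = ⊤ := rfl

theorem imageSeq_succ (φ : V →ₛₗ[s] V) (i : ℕ) :
    imageSeq φ (i + 1) = (imageSeq φ i).map φ :=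
  Function.iterate_succ_apply' _ _ _

theorem mem_imageSeq {φ : V →ₛₗ[s] V} {i : ℕ} {y : V} :
    y ∈ imageSeq φ i ↔ ∃ x, φ^[i] x = y := by
  induction i generalizing y with
  | zero => simp [imageSeq_zero]
  | succ i ih =>
    rw [imageSeq_succ, Submodule.mem_map]
    constructor
    · rintro ⟨z, hz, rfl⟩
      obtain ⟨x, rfl⟩ := ih.1 hz
      exact ⟨x, Function.iterate_succ_apply' _ _ _⟩
    · rintro ⟨x, rfl⟩
      exact ⟨_, ih.2 ⟨x, rfl⟩, (Function.iterate_succ_apply' _ _ _).symm⟩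

end ImageSeq

/-! ### Truncated monomials span -/

section Spanning

open MvPolynomial

variable {F : Type*} [Field F] {A : Type*} [CommRing A] [Algebra F A] {τ : Type*} [Fintype τ]

/-- Replacing a `p`-th power of a generator by a linear combination of generators lowers the degree,
so induction on degree reaches truncated monomials. -/
theorem adjoin_range_eq_span_truncated {p : ℕ} (hp : 2 ≤ p) (f : τ → A)
    (hf : ∀ t, f t ^ p ∈ Submodule.span F (Set.range f)) :
    Subalgebra.toSubmodule (Algebra.adjoin F (Set.range f)) =
      Submodule.span F (Set.range fun e : τ → Fin p => ∏ t, f t ^ (e t : ℕ)) := by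
  classical
  set W := Submodule.span F (Set.range fun e : τ → Fin p => ∏ t, f t ^ (e t : ℕ)) with hW
  have key : ∀ m : τ →₀ ℕ, ∏ t, f t ^ m t ∈ W := by
    intro m
    induction hd : m.degree using Nat.strong_induction_on generalizing m with
    | _ d ih =>
      subst hd
      by_cases h : ∃ t, p ≤ m t
      · obtain ⟨t, ht⟩ := h
        obtain ⟨m', rfl⟩ : ∃ m', m = m' + Finsupp.single t p :=
          ⟨m - Finsupp.single t p, by rw [tsub_add_cancel_of_le]; simpa using ht⟩
        have hadd : ∀ (k : τ) (n : ℕ),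
            ∏ t, f t ^ (m' + Finsupp.single k n) t = f k ^ n * ∏ t, f t ^ m' t := by
          intro k n
          simp only [Finsupp.add_apply, pow_add, Finset.prod_mul_distrib]
          rw [mul_comm, Finset.prod_eq_single k]
          · simp
          · intro j _ hj
            simp [hj.symm]
          · simp
        rw [hadd]
        have hft := hf t
        generalize f t ^ p = z at hft ⊢
        induction hft using Submodule.span_induction with
        | mem x hx =>
          obtain ⟨k, rfl⟩ := hx
          have h1 := hadd k 1
          rw [pow_one] at h1
          rw [← h1]
          refine ih _ ?_ _ rfl
          simp only [map_add, Finsupp.degree_single]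
          omega
        | zero => rw [zero_mul]; exact zero_mem _
        | add x y _ _ hx hy => rw [add_mul]; exact add_mem hx hy
        | smul a x _ hx => rw [smul_mul_assoc]; exact W.smul_mem a hx
      · push Not at h
        exact Submodule.subset_span ⟨fun t => ⟨m t, h t⟩, rfl⟩
  apply le_antisymm
  · intro x hx
    rw [Subalgebra.mem_toSubmodule, Algebra.adjoin_range_eq_range_aeval] at hx
    obtain ⟨q, rfl⟩ := hx
    change aeval f q ∈ W
    induction q using MvPolynomial.induction_on' with
    | add q r hq hr => rw [map_add]; exact add_mem hq hr
    | monomial m a =>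
      rw [aeval_monomial, ← Algebra.smul_def, Finsupp.prod_fintype _ _ (by simp)]
      exact W.smul_mem a (key m)
  · rw [hW, Submodule.span_le]
    rintro _ ⟨e, rfl⟩
    change _ ∈ Algebra.adjoin F (Set.range f)
    exact prod_mem fun t _ => pow_mem (Algebra.subset_adjoin (Set.mem_range_self t)) _

end Spanning

/-! ### Abelian restricted Lie algebras -/

namespace RestrictedLieAlgebra

attribute [local instance] LieRing.ofAssociativeRing

open MvPolynomial TruncatedPolynomial

section Abelian

variable {F : Type*} {p : ℕ} {L : Type*} [Field F] [LieRing L] [LieAlgebra F L]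
  [RestrictedLieAlgebra F p L] [IsLieAbelian L]

variable (F p L) in
/-- The restricted enveloping algebra of an abelian restricted Lie algebra is commutative. -/
abbrev Enveloping.commRing : CommRing (Enveloping F p L) where
  mul_comm a b := by
    have h : ∀ a ∈ Set.range (Enveloping.ι F p L), ∀ b ∈ Set.range (Enveloping.ι F p L),
        a * b = b * a := by
      rintro _ ⟨x, rfl⟩ _ ⟨y, rfl⟩
      rw [← sub_eq_zero, ← Enveloping.ι_lie, trivial_lie_zero, map_zero]
    have ht : ∀ a, a ∈ Algebra.adjoin F (Set.range (Enveloping.ι F p L)) := fun a => by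
      rw [Enveloping.adjoin_range_ι]; trivial
    have := Algebra.isMulCommutative_adjoin F h
    exact congrArg Subtype.val (mul_comm' (⟨a, ht a⟩ : Algebra.adjoin F _) ⟨b, ht b⟩)

attribute [local instance] Enveloping.commRing

variable [Fact p.Prime] [CharP F p]

variable (F p L) in
/-- The `[p]`-mapping of an abelian restricted Lie algebra is `p`-semilinear. -/
def pMapSemilinear : L →ₛₗ[frobenius F p] L where
  toFun := pMap F p
  map_add' x y := by
    rw [pMap_add_of_lie_lie_eq_zero fun x y z => by rw [trivial_lie_zero],
      trivial_lie_zero, ite_self, add_zero]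
  map_smul' a x := pMap_smul a x

theorem pMapSemilinear_apply (x : L) : pMapSemilinear F p L x = pMap F p x := rfl

/-- The map from the restricted enveloping algebra of an abelian restricted Lie algebra to the
truncated polynomial algebra attached to a basis. -/
noncomputable def Enveloping.toTruncated {σ : Type*} (b : Module.Basis σ F L) :
    Enveloping F p L →ₐ[F]
      MvPolynomial σ F ⧸ relIdeal p fun i => b.repr (pMapSemilinear F p L (b i)) :=
  Enveloping.lift
    { toFun := fun x => Ideal.Quotient.mk _ (form b x)
      map_add' := fun x y => by rw [map_add, map_add]
      map_smul' := fun a x => by rw [map_smul]; rfl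
      map_lie' := fun {x y} => by
        rw [trivial_lie_zero, map_zero, map_zero, Ring.lie_def, mul_comm, sub_self] }
    fun x => by
      change Ideal.Quotient.mk _ (form b (pMap F p x)) = Ideal.Quotient.mk _ (form b x) ^ p
      rw [← map_pow]
      exact ((Ideal.Quotient.eq).2 (linearForm_pow_sub_mem b (pMapSemilinear F p L) x)).symm

theorem Enveloping.toTruncated_ι {σ : Type*} (b : Module.Basis σ F L) (x : L) :
    Enveloping.toTruncated (p := p) b (Enveloping.ι F p L x) =
      Ideal.Quotient.mk _ (form b x) :=
  Enveloping.lift_ι _ _ x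

/-- `toTruncated` sends these products to distinct truncated monomials, with exponents extended by
zero off the range of `j`. -/
theorem Enveloping.linearIndependent_basis {σ τ : Type*} [Fintype τ] (b : Module.Basis σ F L)
    (j : τ ↪ σ) : LinearIndependent F fun e : τ → Fin p =>
      ∏ t, Enveloping.ι F p L (b (j t)) ^ (e t : ℕ) := by
  classical
  apply LinearIndependent.of_comp (Enveloping.toTruncated (p := p) b).toLinearMap
  let E : (τ → Fin p) → σ →₀ ℕ := fun e =>
    Finsupp.embDomain j (Finsupp.equivFunOnFinite.symm fun t => (e t : ℕ))
  have hE : Function.Injective E := by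
    intro e e' h
    have h1 := Finsupp.equivFunOnFinite.symm.injective (Finsupp.embDomain_injective j h)
    funext t
    exact Fin.ext (congrFun h1 t)
  have hlt : ∀ e i, E e i < p := by
    intro e i
    by_cases hi : i ∈ Set.range j
    · obtain ⟨t, rfl⟩ := hi
      simp only [E, Finsupp.embDomain_apply_self]
      exact (e t).2
    · simp only [E, Finsupp.embDomain_of_notMem_range _ _ _ hi]
      exact (Fact.out : p.Prime).pos
  have h := linearIndependent_mk_monomial (c := fun i => b.repr (pMapSemilinear F p L (b i)))
    (Fact.out : p.Prime).two_le E hE hlt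
  have heq : (⇑(Enveloping.toTruncated (p := p) b).toLinearMap ∘ fun e : τ → Fin p =>
      ∏ t, Enveloping.ι F p L (b (j t)) ^ (e t : ℕ)) =
      fun e => Ideal.Quotient.mk _ (monomial (E e) (1 : F)) := funext fun e => ?_
  · rw [heq]
    exact h
  simp only [Function.comp, AlgHom.toLinearMap_apply, map_prod, map_pow,
    Enveloping.toTruncated_ι, form_basis]
  rw [monomial_eq, C_1, one_mul, Finsupp.prod_embDomain, Finsupp.prod_fintype _ _ (by simp),
    map_prod]
  simp

theorem Enveloping.linearIndependent_truncated {τ : Type*} [Fintype τ] {v : τ → L}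
    (hv : LinearIndependent F v) : LinearIndependent F fun e : τ → Fin p =>
      ∏ t, Enveloping.ι F p L (v t) ^ (e t : ℕ) := by
  have hs := hv.linearIndepOn_id
  let j : τ ↪ hs.extend (Set.subset_univ _) :=
    ⟨fun t => ⟨v t, hs.subset_extend _ ⟨t, rfl⟩⟩, fun t t' h =>
      hv.injective (congrArg Subtype.val h)⟩
  have h := Enveloping.linearIndependent_basis (p := p) (Module.Basis.extend hs) j
  have hj : ∀ t, Module.Basis.extend hs (j t) = v t := fun t =>
    Module.Basis.extend_apply_self hs _
  simpa only [hj] using h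

variable [RingHomSurjective (frobenius F p)]

/-- The left side depends only on the associative algebra. Taking `p ^ i`-th powers is a ring
endomorphism, so the span of the powers is a subalgebra; it is generated by the image of `imageSeq φ
i`. Since φ preserves that subspace, truncated monomials in a basis of it form a basis of the
subalgebra. -/
theorem Enveloping.finrank_span_range_pow [Module.Finite F L] (i : ℕ) :
    Module.finrank F
      (Submodule.span F (Set.range fun x : Enveloping F p L => x ^ p ^ i)) =
      p ^ Module.finrank F (imageSeq (pMapSemilinear F p L) i) := by
  set φ := pMapSemilinear F p L with hφ
  set B := imageSeq φ i with hB
  let v := Module.finBasis F B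
  let w : Fin (Module.finrank F B) → L := fun t => v t
  have hw : LinearIndependent F w := v.linearIndependent.map' B.subtype B.ker_subtype
  have hspan : Submodule.span F (Set.range w) = B := by
    have : Set.range w = B.subtype '' Set.range v := by
      rw [← Set.range_comp]; rfl
    rw [this, Submodule.span_image, v.span_eq, Submodule.map_top, Submodule.range_subtype]
  let f : Fin (Module.finrank F B) → Enveloping F p L := fun t => Enveloping.ι F p L (w t)
  have hιB : ∀ x ∈ B, Enveloping.ι F p L x ∈ Submodule.span F (Set.range f) := by
    intro x hx
    rw [← hspan] at hx
    have : Set.range f = (Enveloping.ι F p L : L →ₗ[F] Enveloping F p L) '' Set.range w := by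
      rw [← Set.range_comp]; rfl
    rw [this, Submodule.span_image]
    exact ⟨x, hx, rfl⟩
  have hpB : ∀ x ∈ B, pMap F p x ∈ B := by
    intro x hx
    obtain ⟨y, rfl⟩ := mem_imageSeq.1 hx
    exact mem_imageSeq.2 ⟨φ y, by
      rw [← Function.iterate_succ_apply, Function.iterate_succ_apply']; rfl⟩
  have hιi : ∀ x, Enveloping.ι F p L (φ^[i] x) = Enveloping.ι F p L x ^ p ^ i := by
    intro x
    clear_value B
    clear hB
    induction i with
    | zero => simp
    | succ i ih =>
      rw [Function.iterate_succ_apply', hφ, pMapSemilinear_apply, Enveloping.ι_pMap, ← hφ, ih,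
        ← pow_mul, ← pow_succ]
  have hW := adjoin_range_eq_span_truncated (Fact.out : p.Prime).two_le f fun t => by
    rw [← Enveloping.ι_pMap]
    exact hιB _ (hpB _ (v t).2)
  have hchar : ∀ [Nontrivial (Enveloping F p L)], CharP (Enveloping F p L) p := fun {_} =>
    charP_of_injective_algebraMap (algebraMap F (Enveloping F p L)).injective p
  have hWB : Submodule.span F (Set.range fun x : Enveloping F p L => x ^ p ^ i) =
      Subalgebra.toSubmodule (Algebra.adjoin F (Set.range f)) := by
    rcases subsingleton_or_nontrivial (Enveloping F p L) with hsub | hnt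
    · exact Subsingleton.elim _ _
    have := hchar
    apply le_antisymm
    · rw [Submodule.span_le]
      rintro _ ⟨x, rfl⟩
      change x ^ p ^ i ∈ Algebra.adjoin F (Set.range f)
      have hx : x ∈ Algebra.adjoin F (Set.range (Enveloping.ι F p L)) := by
        rw [Enveloping.adjoin_range_ι]; trivial
      induction hx using Algebra.adjoin_induction with
      | mem x hx =>
        obtain ⟨y, rfl⟩ := hx
        rw [← hιi]
        exact Algebra.span_le_adjoin _ _ (hιB _ (mem_imageSeq.2 ⟨y, rfl⟩))
      | algebraMap a => rw [← map_pow]; exact Subalgebra.algebraMap_mem _ _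
      | add x y _ _ hx hy => rw [add_pow_char_pow]; exact add_mem hx hy
      | mul x y _ _ hx hy => rw [mul_pow]; exact mul_mem hx hy
    · set S := Submodule.span F (Set.range fun x : Enveloping F p L => x ^ p ^ i) with hS
      let T : Subalgebra F (Enveloping F p L) := S.toSubalgebra
        (Submodule.subset_span ⟨1, one_pow _⟩) fun x y hx hy => by
          have h := Submodule.mul_mem_mul hx hy
          rw [hS, Submodule.span_mul_span] at h
          refine Submodule.span_mono ?_ h
          rintro _ ⟨_, ⟨a, rfl⟩, _, ⟨b, rfl⟩, rfl⟩
          exact ⟨a * b, mul_pow _ _ _⟩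
      have hT : Algebra.adjoin F (Set.range f) ≤ T := Algebra.adjoin_le (by
        rintro _ ⟨t, rfl⟩
        obtain ⟨y, hy⟩ := mem_imageSeq.1 (v t).2
        refine Submodule.subset_span ⟨Enveloping.ι F p L y, ?_⟩
        change _ ^ _ = Enveloping.ι F p L (v t)
        rw [← hy, hιi])
      exact fun x hx => hT hx
  rw [hWB, hW, finrank_span_eq_card (Enveloping.linearIndependent_truncated hw)]
  simp

theorem Enveloping.finite [Module.Finite F L] : Module.Finite F (Enveloping F p L) := by
  have h := Enveloping.finrank_span_range_pow (F := F) (p := p) (L := L) 0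
  have h1 : (Set.range fun x : Enveloping F p L => x ^ p ^ 0) = Set.univ := by simp
  rw [h1, Submodule.span_univ, finrank_top] at h
  -- An infinite-dimensional space would have `finrank` zero.
  apply Module.finite_of_finrank_pos
  rw [h]
  exact pow_pos (Fact.out : p.Prime).pos _

end Abelian

end RestrictedLieAlgebra

/-! ### Semilinear maps over perfect and algebraically closed fields -/

section Semilinear

variable {F : Type*} [Field F] {s : F →+* F} {V W : Type*} [AddCommGroup V]
  [Module F V] [AddCommGroup W] [Module F W]

/-- A relative complement of `B` in `A ⊔ B` which is contained in `A`. -/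
theorem Submodule.exists_le_disjoint_sup_eq [Module.Finite F V] (A B : Submodule F V) :
    ∃ C ≤ A, Disjoint B C ∧ B ⊔ C = B ⊔ A ∧
      Module.finrank F C + Module.finrank F (A ⊓ B : Submodule F V) = Module.finrank F A := by
  obtain ⟨C, hC⟩ := Submodule.exists_isCompl (A ⊓ B)
  have hsup : A ⊓ B ⊔ C ⊓ A = A := by
    rw [← sup_inf_assoc_of_le _ inf_le_left, hC.sup_eq_top, top_inf_eq]
  have hinf : A ⊓ B ⊓ (C ⊓ A) = ⊥ := by
    rw [← inf_assoc, hC.inf_eq_bot, bot_inf_eq]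
  refine ⟨C ⊓ A, inf_le_right, ?_, ?_, ?_⟩
  · rw [disjoint_iff, eq_bot_iff, ← hinf]
    exact le_inf (le_inf (inf_le_right.trans inf_le_right) inf_le_left) inf_le_right
  · refine le_antisymm (sup_le_sup_left inf_le_right _) (sup_le le_sup_left ?_)
    calc A = A ⊓ B ⊔ C ⊓ A := hsup.symm
      _ ≤ _ := sup_le_sup_right inf_le_right _
  · have h := Submodule.finrank_sup_add_finrank_inf_eq (A ⊓ B) (C ⊓ A)
    rw [hsup, hinf, finrank_bot, add_zero] at h
    rw [h, add_comm]

/-- Rank-nullity: a complement of the kernel part of `S` maps bijectively onto the image, and a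
semilinear bijection over a field automorphism preserves dimension. -/
theorem finrank_map_add_finrank_inf_ker [Module.Finite F V] [RingHomSurjective s]
    (hs : Function.Bijective s) (φ : V →ₛₗ[s] W) (S : Submodule F V) :
    Module.finrank F (S.map φ) + Module.finrank F (S ⊓ LinearMap.ker φ : Submodule F V) =
      Module.finrank F S := by
  obtain ⟨C, hCS, hdisj, hsup, hrank⟩ := Submodule.exists_le_disjoint_sup_eq S (LinearMap.ker φ)
  have hmem : ∀ x : C, φ x ∈ S.map φ := fun x => ⟨x, hCS x.2, rfl⟩
  let j : C →+ S.map φ :=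
    { toFun := fun x => ⟨φ x, hmem x⟩
      map_zero' := Subtype.ext (map_zero φ)
      map_add' := fun x y => Subtype.ext (map_add φ _ _) }
  have hj : Function.Bijective j := by
    constructor
    · rw [injective_iff_map_eq_zero]
      intro x hx
      exact Subtype.ext (Submodule.disjoint_def.1 hdisj x (congrArg Subtype.val hx) x.2)
    · rintro ⟨_, x, hx, rfl⟩
      have hx' : x ∈ LinearMap.ker φ ⊔ C := hsup ▸ Submodule.mem_sup_right hx
      obtain ⟨k, hk, c, hc, rfl⟩ := Submodule.mem_sup.1 hx'
      refine ⟨⟨c, hc⟩, Subtype.ext ?_⟩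
      change φ c = φ (k + c)
      rw [map_add, LinearMap.mem_ker.1 hk, zero_add]
  have h := lift_rank_eq_of_equiv_equiv s (AddEquiv.ofBijective j hj) hs fun r x =>
    Subtype.ext (map_smulₛₗ φ r (x : V))
  have h' := congrArg Cardinal.toNat h
  rw [Cardinal.toNat_lift, Cardinal.toNat_lift] at h'
  rw [← hrank]
  exact congrArg (· + _) h'.symm

theorem injective_of_surjective_semilinear [Module.Finite F V]
    (hs : Function.Bijective s) (φ : V →ₛₗ[s] V) (hφ : Function.Surjective φ) :
    Function.Injective φ := by
  have : RingHomSurjective s := ⟨hs.2⟩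
  have h := finrank_map_add_finrank_inf_ker hs φ ⊤
  rw [Submodule.map_top, LinearMap.range_eq_top.2 hφ, top_inf_eq] at h
  rw [← LinearMap.ker_eq_bot]
  exact Submodule.finrank_eq_zero.1 (by omega)

/-- A semilinear map with values in the range of another one factors through it linearly. -/
theorem exists_linear_lift (ψ : W →ₛₗ[s] W) (h : V →ₛₗ[s] W) (hh : ∀ v, ∃ w, ψ w = h v) :
    ∃ d : V →ₗ[F] W, ∀ v, ψ (d v) = h v := by
  let b := Module.Basis.ofVectorSpace F V
  choose w hw using hh
  refine ⟨b.constr F fun i => w (b i), ?_⟩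
  have : ψ.comp (b.constr F fun i => w (b i)) = h := b.ext fun i => by
    rw [LinearMap.comp_apply, Module.Basis.constr_basis, hw]
  exact fun v => LinearMap.congr_fun this v

/-- The defect `g - ψ ∘ f₀` vanishes on `U`, hence descends to `V ⧸ U`; a lift of it there corrects
`f₀` without changing it on `U`. -/
theorem exists_linear_lift_of_eqOn (ψ : W →ₛₗ[s] W) (g : V →ₛₗ[s] W) (U : Submodule F V)
    (f₀ : V →ₗ[F] W) (hg : ∀ v, ∃ w, ψ w = g v) (hU : ∀ u ∈ U, ψ (f₀ u) = g u) :
    ∃ f : V →ₗ[F] W, (∀ u ∈ U, f u = f₀ u) ∧ ∀ v, ψ (f v) = g v := by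
  let h : V →ₛₗ[s] W := g - ψ.comp f₀
  have hh : ∀ v, h v = g v - ψ (f₀ v) := fun v => rfl
  let h' : (V ⧸ U) →ₛₗ[s] W := U.liftQ h fun u hu => by
    rw [LinearMap.mem_ker, hh, hU u hu, sub_self]
  have hh' : ∀ v, h' (U.mkQ v) = g v - ψ (f₀ v) := fun v => rfl
  obtain ⟨d, hd⟩ := exists_linear_lift ψ h' fun v => by
    obtain ⟨v, rfl⟩ := U.mkQ_surjective v
    obtain ⟨w, hw⟩ := hg v
    exact ⟨w - f₀ v, by rw [map_sub, hw, hh']⟩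
  refine ⟨f₀ + d ∘ₗ U.mkQ, fun u hu => ?_, fun v => ?_⟩
  · have : U.mkQ u = 0 := (Submodule.Quotient.mk_eq_zero _).2 hu
    rw [LinearMap.add_apply, LinearMap.comp_apply, this, map_zero, add_zero]
  · rw [LinearMap.add_apply, LinearMap.comp_apply, map_add, hd, hh', add_sub_cancel]

end Semilinear

/-! ### Fixed vectors of Frobenius-semilinear maps -/

section Lang

open Polynomial

variable {F : Type*} [Field F] {p : ℕ} [Fact p.Prime] [CharP F p] {V : Type*} [AddCommGroup V]
  [Module F V]

/-- The polynomials `C₀ = a₀ X ^ p`, `Cₖ₊₁ = Cₖ ^ p + aₖ₊₁ X ^ p`, giving the coefficients of a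
fixed vector in a cyclic subspace. -/
noncomputable def fixedPoly (p : ℕ) (a : ℕ → F) : ℕ → F[X]
  | 0 => C (a 0) * X ^ p
  | k + 1 => fixedPoly p a k ^ p + C (a (k + 1)) * X ^ p

omit [CharP F p] in
theorem natDegree_fixedPoly {a : ℕ → F} (ha : a 0 ≠ 0) (k : ℕ) :
    (fixedPoly p a k).natDegree = p ^ (k + 1) := by
  have hp : 1 < p := (Fact.out : p.Prime).one_lt
  induction k with
  | zero => rw [fixedPoly, natDegree_C_mul_X_pow _ _ ha, zero_add, pow_one]
  | succ k ih =>
    have h1 : (fixedPoly p a k ^ p).natDegree = p ^ (k + 1 + 1) := by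
      rw [natDegree_pow, ih, ← pow_succ']
    rw [fixedPoly, natDegree_add_eq_left_of_natDegree_lt, h1]
    rw [h1]
    refine lt_of_le_of_lt (natDegree_C_mul_X_pow_le _ _) ?_
    exact lt_self_pow₀ hp (by omega)

omit [CharP F p] in
theorem X_sq_dvd_fixedPoly (a : ℕ → F) (k : ℕ) : X ^ 2 ∣ fixedPoly p a k := by
  have hp : 2 ≤ p := (Fact.out : p.Prime).two_le
  have h : ∀ c : F, X ^ 2 ∣ C c * X ^ p := fun c => (pow_dvd_pow X hp).mul_left _
  induction k with
  | zero => exact h _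
  | succ k ih => exact dvd_add (ih.trans (dvd_pow_self _ (by omega))) (h _)

-- Divisibility by `X ^ 2` turns the equation, for nonzero `x`, into `x * q(x) = 1`: it is
-- nonconstant, and its roots are automatically nonzero.
omit [CharP F p] in
theorem exists_fixedPoly_eval_eq [IsAlgClosed F] {a : ℕ → F} (ha : a 0 ≠ 0) (k : ℕ) :
    ∃ x : F, x ≠ 0 ∧ (fixedPoly p a k).eval x = x := by
  obtain ⟨q, hq⟩ := X_sq_dvd_fixedPoly (p := p) a k
  have hq0 : q ≠ 0 := by
    rintro rfl
    have := natDegree_fixedPoly (p := p) ha k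
    rw [hq, mul_zero, natDegree_zero] at this
    exact (pow_pos (Fact.out : p.Prime).pos _).ne this
  have hdeg : (X * q - 1).degree ≠ 0 := by
    have h1 : (X * q).natDegree = q.natDegree + 1 := natDegree_X_mul hq0
    have h2 : (X * q - 1).natDegree = q.natDegree + 1 := by
      rw [natDegree_sub_eq_left_of_natDegree_lt, h1]
      rw [h1, natDegree_one]
      omega
    intro h
    rw [natDegree_eq_of_degree_eq_some (n := 0) h] at h2
    omega
  obtain ⟨x, hx⟩ := IsAlgClosed.exists_root _ hdeg
  have hx1 : x * q.eval x = 1 := by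
    have : (X * q - 1).eval x = 0 := hx
    simpa [sub_eq_zero] using this
  refine ⟨x, left_ne_zero_of_mul_eq_one hx1, ?_⟩
  rw [hq, eval_mul, eval_pow, eval_X, sq, mul_assoc, hx1, mul_one]

/-- Over an algebraically closed field, an injective `p`-semilinear endomorphism of a nonzero
finite-dimensional space has a nonzero fixed vector. -/
theorem exists_fixed_ne_zero [IsAlgClosed F] [Module.Finite F V] [Nontrivial V]
    (φ : V →ₛₗ[frobenius F p] V) (hφ : Function.Injective φ) : ∃ v, v ≠ 0 ∧ φ v = v := by
  classical
  have hpr : p.Prime := Fact.out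
  obtain ⟨v, hv⟩ := exists_ne (0 : V)
  have hex : ∃ n, ¬ LinearIndependent F fun i : Fin n => φ^[i] v := by
    refine ⟨Module.finrank F V + 1, fun h => ?_⟩
    have := h.fintype_card_le_finrank
    simp at this
  obtain ⟨n, hn, hmin⟩ : ∃ n, ¬ LinearIndependent F (fun i : Fin n => φ^[i] v) ∧
      ∀ m < n, LinearIndependent F fun i : Fin m => φ^[i] v :=
    ⟨Nat.find hex, Nat.find_spec hex, fun m hm => not_not.1 (Nat.find_min hex hm)⟩
  obtain ⟨n, rfl⟩ : ∃ k, n = k + 2 := by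
    rcases n with _ | _ | n
    · exact absurd (linearIndependent_empty_type) hn
    · exact absurd (LinearIndependent.of_subsingleton (0 : Fin 1) (by simpa using hv)) hn
    · exact ⟨n, rfl⟩
  have hli := hmin (n + 1) (by omega)
  have hmem : φ^[n + 1] v ∈ Submodule.span F (Set.range fun i : Fin (n + 1) => φ^[i] v) := by
    by_contra hnot
    refine hn ?_
    rw [linearIndependent_finSucc']
    exact ⟨hli, hnot⟩
  obtain ⟨a', ha'⟩ := (Submodule.mem_span_range_iff_exists_fun F).1 hmem
  let a : ℕ → F := fun k => if h : k < n + 1 then a' ⟨k, h⟩ else 0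
  have ha : ∑ i ∈ Finset.range (n + 1), a i • φ^[i] v = φ^[n + 1] v := by
    rw [Finset.sum_range, ← ha']
    refine Finset.sum_congr rfl fun i _ => ?_
    simp only [a, dif_pos i.2]
  have hinj : Function.Injective (frobenius F p) := frobenius_inj F p
  have hsurj : Function.Surjective (frobenius F p) := (bijective_frobenius F p).2
  have hindep : ∀ c : ℕ → F, ∑ i ∈ Finset.range (n + 1), c i • φ^[i] v = 0 → ∀ i ≤ n, c i = 0 := by
    intro c hc i hi
    rw [Finset.sum_range] at hc
    exact Fintype.linearIndependent_iff.1 hli (fun i => c i) hc ⟨i, by omega⟩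
  -- If `a 0 = 0`, taking `p`-th roots of the coefficients and using injectivity strips one `φ` from
  -- the relation, contradicting minimality.
  have ha0 : a 0 ≠ 0 := by
    intro h0
    choose r hr using hsurj
    have h1 : φ (φ^[n] v - ∑ i ∈ Finset.range n, r (a (i + 1)) • φ^[i] v) = 0 := by
      rw [map_sub, map_sum, ← Function.iterate_succ_apply' φ, ← ha, Finset.sum_range_succ', h0,
        zero_smul, add_zero, sub_eq_zero]
      refine Finset.sum_congr rfl fun i _ => ?_
      rw [map_smulₛₗ, hr, Function.iterate_succ_apply']
    have h2 := hφ (h1.trans (map_zero φ).symm)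
    have h3 := hindep (fun i => if i = n then 1 else - r (a (i + 1))) (by
      rw [Finset.sum_range_succ, if_pos rfl, one_smul, ← h2, sub_eq_add_neg, add_comm,
        ← Finset.sum_neg_distrib]
      congr 1
      refine Finset.sum_congr rfl fun i hi => ?_
      rw [if_neg (Finset.mem_range.1 hi).ne, neg_smul]) n le_rfl
    simp at h3
  -- Comparing coefficients in φ(w) = w, with `x` the top coefficient of w, determines all
  -- coefficients recursively as `fixedPoly` values at `x`; consistency at the top is the equation
  -- solved here.
  obtain ⟨x, hx0, hx⟩ := exists_fixedPoly_eval_eq (p := p) ha0 n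
  set c : ℕ → F := fun k => (fixedPoly p a k).eval x with hc
  have hc0 : c 0 = a 0 * x ^ p := by simp [hc, fixedPoly]
  have hcs : ∀ k, c (k + 1) = c k ^ p + a (k + 1) * x ^ p := fun k => by simp [hc, fixedPoly]
  have hcn : c n = x := hx
  refine ⟨∑ i ∈ Finset.range (n + 1), c i • φ^[i] v, fun h => ?_, ?_⟩
  · exact hx0 (hcn.symm.trans (hindep c h n le_rfl))
  · have h1 : φ (∑ i ∈ Finset.range (n + 1), c i • φ^[i] v) =
        ∑ i ∈ Finset.range n, c i ^ p • φ^[i + 1] v + x ^ p • φ^[n + 1] v := by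
      rw [map_sum, Finset.sum_range_succ, map_smulₛₗ, hcn, frobenius_def,
        Function.iterate_succ_apply']
      congr 1
      refine Finset.sum_congr rfl fun i _ => ?_
      rw [map_smulₛₗ, frobenius_def, Function.iterate_succ_apply']
    rw [h1, ← ha, Finset.smul_sum, Finset.sum_range_succ', Finset.sum_range_succ' (n := n),
      ← add_assoc, ← Finset.sum_add_distrib, hc0, smul_smul, mul_comm (x ^ p)]
    congr 1
    refine Finset.sum_congr rfl fun i _ => ?_
    rw [hcs, add_smul, smul_smul, mul_comm (x ^ p)]

omit [CharP F p] in
theorem exists_pow_sub_self_eq [IsAlgClosed F] (a : F) : ∃ x : F, x ^ p - x = a := by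
  have hp : 1 < p := (Fact.out : p.Prime).one_lt
  have h1 : (X + C a : F[X]).natDegree < (X ^ p : F[X]).natDegree := by
    rw [natDegree_X_pow, natDegree_X_add_C]; exact hp
  have h2 : (X ^ p - (X + C a) : F[X]).natDegree = p := by
    rw [natDegree_sub_eq_left_of_natDegree_lt h1, natDegree_X_pow]
  obtain ⟨x, hx⟩ := IsAlgClosed.exists_root (X ^ p - (X + C a) : F[X]) (fun h => by
    rw [natDegree_eq_of_degree_eq_some (n := 0) h] at h2; omega)
  refine ⟨x, ?_⟩
  have : (X ^ p - (X + C a) : F[X]).eval x = 0 := hx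
  simp only [eval_sub, eval_pow, eval_X, eval_add, eval_C] at this
  linear_combination this

/-- **Lang's theorem** for `p`-semilinear maps: the fixed vectors span. -/
theorem span_fixed_eq_top [IsAlgClosed F] [Module.Finite F V]
    (φ : V →ₛₗ[frobenius F p] V) (hφ : Function.Surjective φ) :
    Submodule.span F {v | φ v = v} = ⊤ := by
  set U := Submodule.span F {v | φ v = v} with hU
  have hUφ : ∀ u ∈ U, φ u ∈ U := by
    intro u hu
    induction hu using Submodule.span_induction with
    | mem u hu => rw [show φ u = u from hu]; exact Submodule.subset_span hu
    | zero => rw [map_zero]; exact zero_mem _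
    | add x y _ _ hx hy => rw [map_add]; exact add_mem hx hy
    | smul a x _ hx => rw [map_smulₛₗ]; exact U.smul_mem _ hx
  -- `φ - 1` maps `U` onto itself, by Artin–Schreier equations on fixed vectors. The scalar `a` is
  -- there to carry the induction through scalar multiples.
  have hAS : ∀ u ∈ U, ∀ a : F, ∃ x ∈ U, φ x - x = a • u := by
    intro u hu
    induction hu using Submodule.span_induction with
    | mem u hu =>
      intro a
      obtain ⟨c, hc⟩ := exists_pow_sub_self_eq (p := p) a
      refine ⟨c • u, U.smul_mem _ (Submodule.subset_span hu), ?_⟩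
      rw [map_smulₛₗ, show φ u = u from hu, frobenius_def, ← sub_smul, hc]
    | zero => exact fun a => ⟨0, zero_mem _, by simp⟩
    | add x y _ _ hx hy =>
      intro a
      obtain ⟨x', hx', hx⟩ := hx a
      obtain ⟨y', hy', hy⟩ := hy a
      exact ⟨x' + y', add_mem hx' hy', by rw [map_add, smul_add, ← hx, ← hy]; abel⟩
    | smul b x _ hx =>
      intro a
      obtain ⟨x', hx', hx⟩ := hx (a * b)
      exact ⟨x', hx', by rw [hx, mul_smul]⟩
  -- A nonzero fixed vector of the quotient lifts, after correction by an element of `U`, to a fixed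
  -- vector outside `U`.
  by_contra hne
  have : Nontrivial (V ⧸ U) := Submodule.Quotient.nontrivial_iff.2 hne
  let φ' : (V ⧸ U) →ₛₗ[frobenius F p] (V ⧸ U) := U.mapQ U φ hUφ
  have hφ' : Function.Surjective φ' := by
    intro y
    obtain ⟨y, rfl⟩ := U.mkQ_surjective y
    obtain ⟨x, rfl⟩ := hφ y
    exact ⟨U.mkQ x, rfl⟩
  obtain ⟨v, hv0, hv⟩ := exists_fixed_ne_zero φ'
    (injective_of_surjective_semilinear (bijective_frobenius F p) φ' hφ')
  obtain ⟨v, rfl⟩ := U.mkQ_surjective v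
  have hv1 : φ v - v ∈ U := (Submodule.Quotient.eq U).1 hv
  obtain ⟨x, hxU, hx⟩ := hAS _ hv1 1
  rw [one_smul] at hx
  have hfix : φ (v - x) = v - x := by
    rw [map_sub, ← sub_eq_zero]
    rw [← sub_eq_zero] at hx
    rw [← neg_eq_zero, ← hx]
    abel
  have h1 : v - x ∈ U := Submodule.subset_span hfix
  have h2 : v ∈ U := by simpa using add_mem h1 hxU
  exact hv0 ((Submodule.Quotient.mk_eq_zero _).2 h2)

theorem exists_basis_fixed [IsAlgClosed F] [Module.Finite F V]
    (φ : V →ₛₗ[frobenius F p] V) (hφ : Function.Surjective φ) :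
    ∃ b : Module.Basis (Fin (Module.finrank F V)) F V, ∀ i, φ (b i) = b i := by
  obtain ⟨κ, b, hb⟩ : ∃ (κ : Set V) (b : Module.Basis κ F V), ∀ i, φ (b i) = b i := by
    refine ⟨_, Module.Basis.ofSpan (span_fixed_eq_top φ hφ).ge, fun i => ?_⟩
    have h := Module.Basis.ofSpan_subset (span_fixed_eq_top φ hφ).ge (Set.mem_range_self i)
    exact h
  have : Fintype κ := FiniteDimensional.fintypeBasisIndex b
  refine ⟨b.reindex (Fintype.equivFinOfCardEq (Module.finrank_eq_card_basis b).symm),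
    fun i => ?_⟩
  rw [Module.Basis.reindex_apply, hb]

end Lang

/-! ### Classification of semilinear endomorphisms by the dimensions of iterated images -/

section Restriction

variable {F : Type*} [Field F] {s : F →+* F} [RingHomSurjective s] {V : Type*} [AddCommGroup V]
  [Module F V]

theorem mem_imageSeq_one (φ : V →ₛₗ[s] V) (x : V) : φ x ∈ imageSeq φ 1 :=
  mem_imageSeq.2 ⟨x, rfl⟩

/-- The restriction of a semilinear endomorphism to its image. -/
def restrictImage (φ : V →ₛₗ[s] V) : imageSeq φ 1 →ₛₗ[s] imageSeq φ 1 where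
  toFun x := ⟨φ x, mem_imageSeq_one φ x⟩
  map_add' _ _ := Subtype.ext (map_add φ _ _)
  map_smul' a x := Subtype.ext (map_smulₛₗ φ a (x : V))

theorem coe_restrictImage (φ : V →ₛₗ[s] V) (x : imageSeq φ 1) :
    (restrictImage φ x : V) = φ x := rfl

theorem coe_iterate_restrictImage (φ : V →ₛₗ[s] V) (i : ℕ) (x : imageSeq φ 1) :
    ((restrictImage φ)^[i] x : V) = φ^[i] x := by
  induction i with
  | zero => rfl
  | succ i ih =>
    rw [Function.iterate_succ_apply', Function.iterate_succ_apply', coe_restrictImage, ih]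

theorem finrank_imageSeq_restrictImage (φ : V →ₛₗ[s] V) (i : ℕ) :
    Module.finrank F (imageSeq (restrictImage φ) i) = Module.finrank F (imageSeq φ (i + 1)) := by
  have h : (imageSeq (restrictImage φ) i).map (imageSeq φ 1).subtype = imageSeq φ (i + 1) := by
    ext y
    rw [Submodule.mem_map, mem_imageSeq]
    constructor
    · rintro ⟨x, hx, rfl⟩
      obtain ⟨⟨z, hz⟩, rfl⟩ := mem_imageSeq.1 hx
      obtain ⟨z, rfl⟩ := mem_imageSeq.1 hz
      exact ⟨z, (coe_iterate_restrictImage φ i ⟨φ z, hz⟩).symm⟩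
    · rintro ⟨z, rfl⟩
      exact ⟨_, mem_imageSeq.2 ⟨⟨φ z, mem_imageSeq_one φ z⟩, rfl⟩,
        coe_iterate_restrictImage φ i _⟩
  rw [← h, Submodule.finrank_map_subtype_eq]

variable [Module.Finite F V]

/-- The kernel has a part disjoint from the image, whose dimension is determined by the dimensions
of the iterated images. -/
theorem exists_ker_part (hs : Function.Bijective s) (φ : V →ₛₗ[s] V) :
    ∃ C ≤ LinearMap.ker φ, Disjoint (imageSeq φ 1) C ∧
      imageSeq φ 1 ⊔ C = imageSeq φ 1 ⊔ LinearMap.ker φ ∧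
      Module.finrank F C + 2 * Module.finrank F (imageSeq φ 1) =
        Module.finrank F V + Module.finrank F (imageSeq φ 2) := by
  obtain ⟨C, hC, h1, h2, h3⟩ :=
    Submodule.exists_le_disjoint_sup_eq (LinearMap.ker φ) (imageSeq φ 1)
  refine ⟨C, hC, h1, h2, ?_⟩
  -- Rank-nullity on `V` gives the dimension of the kernel, and on the image that of its
  -- intersection with the kernel.
  have h4 := finrank_map_add_finrank_inf_ker hs φ (imageSeq φ 0)
  have h5 := finrank_map_add_finrank_inf_ker hs φ (imageSeq φ 1)
  rw [← imageSeq_succ] at h4 h5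
  rw [imageSeq_zero, top_inf_eq, finrank_top, zero_add] at h4
  rw [inf_comm] at h5
  simp only [Nat.reduceAdd] at h5
  omega

end Restriction

section Classification

variable {F : Type*} [Field F]

theorem exists_linearMap_of_disjoint {V W : Type*} [AddCommGroup V] [Module F V] [AddCommGroup W]
    [Module F W] {A B : Submodule F V} (h : Disjoint A B) (f : A →ₗ[F] W) (g : B →ₗ[F] W) :
    ∃ k : V →ₗ[F] W, (∀ x : A, k x = f x) ∧ ∀ x : B, k x = g x := by
  obtain ⟨A', hA, hc⟩ := h.exists_isCompl
  obtain ⟨f', hf'⟩ := f.exists_extend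
  refine ⟨LinearMap.ofIsCompl hc (f' ∘ₗ A'.subtype) g, fun x => ?_, fun x => ?_⟩
  · have := LinearMap.ofIsCompl_apply_left hc (φ := f' ∘ₗ A'.subtype) (ψ := g) ⟨x, hA x.2⟩
    exact this.trans (LinearMap.congr_fun hf' x)
  · exact LinearMap.ofIsCompl_apply_right hc x

/-- Extension of an isomorphism from the images to the whole spaces. -/
theorem exists_equiv_of_restrictImage {s : F →+* F} [RingHomSurjective s]
    (hs : Function.Bijective s) {V W : Type*} [AddCommGroup V] [Module F V] [AddCommGroup W]
    [Module F W] [Module.Finite F V] [Module.Finite F W] (φ : V →ₛₗ[s] V) (ψ : W →ₛₗ[s] W)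
    (hdim : ∀ i, Module.finrank F (imageSeq φ i) = Module.finrank F (imageSeq ψ i))
    (f : imageSeq φ 1 ≃ₗ[F] imageSeq ψ 1)
    (hf : ∀ x, f (restrictImage φ x) = restrictImage ψ (f x)) :
    ∃ g : V ≃ₗ[F] W, ∀ x, g (φ x) = ψ (g x) := by
  have hVW : Module.finrank F V = Module.finrank F W := by
    have h := hdim 0
    rwa [imageSeq_zero, imageSeq_zero, finrank_top, finrank_top] at h
  obtain ⟨C, hC, hCd, hCs, hCr⟩ := exists_ker_part hs φ
  obtain ⟨D, hD, hDd, hDs, hDr⟩ := exists_ker_part hs ψ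
  have e : C ≃ₗ[F] D := LinearEquiv.ofFinrankEq _ _ (by
    have := hdim 1
    have := hdim 2
    omega)
  obtain ⟨g₀, hg₁, hg₂⟩ := exists_linearMap_of_disjoint hCd
    ((imageSeq ψ 1).subtype ∘ₗ f.toLinearMap) (D.subtype ∘ₗ e.toLinearMap)
  let t : V →ₛₗ[s] W :=
    { toFun := fun x => f ⟨φ x, mem_imageSeq_one φ x⟩
      map_add' := fun x y => by
        rw [← Submodule.coe_add, ← map_add]
        congr 2
        exact Subtype.ext (map_add φ x y)
      map_smul' := fun a x => by
        rw [← Submodule.coe_smul, ← map_smul]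
        congr 2
        exact Subtype.ext (map_smulₛₗ φ a x) }
  have ht : ∀ x, t x = f ⟨φ x, mem_imageSeq_one φ x⟩ := fun x => rfl
  -- Any intertwining extension `g` of `f` must satisfy `ψ ∘ g = t`. On the image `g₀` does so by
  -- `hf`; on `C` both sides vanish.
  obtain ⟨g, hgU, hg⟩ := exists_linear_lift_of_eqOn ψ t (imageSeq φ 1 ⊔ C) g₀
    (fun v => by
      obtain ⟨w, hw⟩ := mem_imageSeq.1 (f ⟨φ v, mem_imageSeq_one φ v⟩).2
      exact ⟨w, hw⟩)
    (fun u hu => by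
      obtain ⟨x, hx, c, hc, rfl⟩ := Submodule.mem_sup.1 hu
      have h1 := hg₁ ⟨x, hx⟩
      have h2 := hg₂ ⟨c, hc⟩
      have h3 : t c = 0 := by
        have : (⟨φ c, mem_imageSeq_one φ c⟩ : imageSeq φ 1) = 0 :=
          Subtype.ext (LinearMap.mem_ker.1 (hC hc))
        rw [ht, this, map_zero, Submodule.coe_zero]
      have h4 : ψ (g₀ c) = 0 := by
        rw [h2]
        exact LinearMap.mem_ker.1 (hD (e ⟨c, hc⟩).2)
      rw [map_add, map_add, map_add, h3, h4, add_zero, add_zero, h1]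
      exact congrArg Subtype.val (hf ⟨x, hx⟩).symm)
  have hgf : ∀ x : imageSeq φ 1, g x = f x := fun x =>
    (hgU x (Submodule.mem_sup_left x.2)).trans (hg₁ x)
  have hrange : imageSeq ψ 1 ⊔ D ≤ LinearMap.range g := by
    refine sup_le (fun w hw => ?_) (fun w hw => ?_)
    · refine ⟨f.symm ⟨w, hw⟩, ?_⟩
      rw [hgf, f.apply_symm_apply]
    · refine ⟨e.symm ⟨w, hw⟩, ?_⟩
      rw [hgU _ (Submodule.mem_sup_right (e.symm ⟨w, hw⟩).2), hg₂]
      simp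
  -- Some `g v` agrees with `w` modulo the kernel of `ψ`, and that kernel lies in `imageSeq ψ 1 ⊔
  -- D`, already covered by `g`.
  have hsurj : Function.Surjective g := by
    intro w
    obtain ⟨v, hv⟩ := mem_imageSeq.1 (f.symm ⟨ψ w, mem_imageSeq_one ψ w⟩).2
    have h1 : ψ (g v) = ψ w := by
      rw [hg, ht]
      have : (⟨φ v, mem_imageSeq_one φ v⟩ : imageSeq φ 1) =
        f.symm ⟨ψ w, mem_imageSeq_one ψ w⟩ := Subtype.ext hv
      rw [this, f.apply_symm_apply]
    have h2 : w - g v ∈ LinearMap.ker ψ := by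
      rw [LinearMap.mem_ker, map_sub, h1, sub_self]
    obtain ⟨v', hv'⟩ := hrange (hDs ▸ Submodule.mem_sup_right h2)
    exact ⟨v' + v, by rw [map_add, hv', sub_add_cancel]⟩
  have hinj := (LinearMap.injective_iff_surjective_of_finrank_eq_finrank hVW).2 hsurj
  refine ⟨LinearEquiv.ofBijective g ⟨hinj, hsurj⟩, fun x => ?_⟩
  change g (φ x) = ψ (g x)
  rw [hg, ht]
  exact hgf ⟨φ x, mem_imageSeq_one φ x⟩

/-- Over an algebraically closed field, or if one of them is nilpotent over a perfect field,
`p`-semilinear endomorphisms of finite-dimensional spaces are determined up to isomorphism by the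
dimensions of the images of their iterates. -/
theorem exists_equiv_of_finrank_imageSeq {p : ℕ} [Fact p.Prime] [CharP F p] [PerfectRing F p]
    [RingHomSurjective (frobenius F p)] {V W : Type*} [AddCommGroup V] [Module F V]
    [AddCommGroup W] [Module F W] [Module.Finite F V] [Module.Finite F W]
    (φ : V →ₛₗ[frobenius F p] V) (ψ : W →ₛₗ[frobenius F p] W)
    (hdim : ∀ i, Module.finrank F (imageSeq φ i) = Module.finrank F (imageSeq ψ i))
    (h : IsAlgClosed F ∨ ∃ k, ∀ x, φ^[k] x = 0) :
    ∃ g : V ≃ₗ[F] W, ∀ x, g (φ x) = ψ (g x) := by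
  induction hn : Module.finrank F V using Nat.strong_induction_on generalizing V W with
  | _ n ih =>
    subst hn
    have hVW : Module.finrank F V = Module.finrank F W := by
      have h := hdim 0
      rwa [imageSeq_zero, imageSeq_zero, finrank_top, finrank_top] at h
    by_cases hlt : Module.finrank F (imageSeq φ 1) < Module.finrank F V
    · obtain ⟨f, hf⟩ := ih _ hlt (restrictImage φ) (restrictImage ψ)
        (fun i => by rw [finrank_imageSeq_restrictImage, finrank_imageSeq_restrictImage, hdim])
        (h.imp_right fun ⟨k, hk⟩ => ⟨k, fun x => Subtype.ext
          ((coe_iterate_restrictImage φ k x).trans (hk x))⟩) rfl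
      exact exists_equiv_of_restrictImage (bijective_frobenius F p) φ ψ hdim f hf
    · have hφ1 : imageSeq φ 1 = ⊤ := Submodule.eq_top_of_finrank_eq
        (le_antisymm (Submodule.finrank_le _) (not_lt.1 hlt))
      have hψ1 : imageSeq ψ 1 = ⊤ := Submodule.eq_top_of_finrank_eq (by
        rw [← hdim, hφ1, finrank_top, hVW])
      have hφ : Function.Surjective φ := fun x =>
        mem_imageSeq.1 (hφ1.symm ▸ Submodule.mem_top : x ∈ imageSeq φ 1)
      have hψ : Function.Surjective ψ := fun x =>
        mem_imageSeq.1 (hψ1.symm ▸ Submodule.mem_top : x ∈ imageSeq ψ 1)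
      -- Both maps are now surjective: bases of fixed vectors can be matched, or nilpotence makes
      -- the spaces zero.
      rcases h with h | ⟨k, hk⟩
      · obtain ⟨b, hb⟩ := exists_basis_fixed φ hφ
        obtain ⟨c, hc⟩ := exists_basis_fixed ψ hψ
        let g : V ≃ₗ[F] W := b.equiv c (finCongr hVW)
        have hgb : ∀ i, g (b i) = c (finCongr hVW i) := fun i => b.equiv_apply i c _
        have hg : g.toLinearMap.comp φ = ψ.comp g.toLinearMap := b.ext fun i => by
          rw [LinearMap.comp_apply, LinearMap.comp_apply, hb, LinearEquiv.coe_coe, hgb, hc]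
        exact ⟨g, fun x => LinearMap.congr_fun hg x⟩
      · have hV : Subsingleton V := ⟨fun x y => by
          obtain ⟨x', rfl⟩ := (hφ.iterate k) x
          obtain ⟨y', rfl⟩ := (hφ.iterate k) y
          rw [hk, hk]⟩
        have hW : Subsingleton W := by
          rw [← Module.finrank_zero_iff (R := F), ← hVW]
          exact Module.finrank_zero_of_subsingleton
        exact ⟨LinearEquiv.ofFinrankEq _ _ hVW, fun x => Subsingleton.elim _ _⟩

end Classification

/-! ### Transport of the invariants and conclusion -/

theorem AlgEquiv.finrank_span_range_pow {F A B : Type*} [Field F] [Ring A] [Algebra F A] [Ring B]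
    [Algebra F B] (e : A ≃ₐ[F] B) (n : ℕ) :
    Module.finrank F (Submodule.span F (Set.range fun x : A => x ^ n)) =
      Module.finrank F (Submodule.span F (Set.range fun x : B => x ^ n)) := by
  have h : (Submodule.span F (Set.range fun x : A => x ^ n)).map e.toLinearEquiv.toLinearMap =
      Submodule.span F (Set.range fun x : B => x ^ n) := by
    rw [Submodule.map_span, ← Set.range_comp]
    congr 1
    ext y
    constructor
    · rintro ⟨x, rfl⟩
      exact ⟨e x, (map_pow e x n).symm⟩
    · rintro ⟨y, rfl⟩
      refine ⟨e.symm y, (map_pow e _ n).trans ?_⟩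
      rw [e.apply_symm_apply]
  rw [← h]
  exact (LinearEquiv.finrank_map_eq e.toLinearEquiv _).symm

/-- The theorem for perfect fields, given one of the two finiteness hypotheses on the
`[p]`-mapping or the field. -/
theorem RestrictedLieAlgebra.nonempty_iso_of_enveloping_equiv {F : Type*} [Field F] {p : ℕ}
    [Fact p.Prime] [CharP F p] [PerfectField F]
    {L : Type*} [LieRing L] [LieAlgebra F L] [RestrictedLieAlgebra F p L]
    [Module.Finite F L] [IsLieAbelian L]
    {H : Type*} [LieRing H] [LieAlgebra F H] [RestrictedLieAlgebra F p H]
    (e : Enveloping F p L ≃ₐ[F] Enveloping F p H)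
    (h : IsAlgClosed F ∨ IsPNilpotent F p L) : Nonempty (Iso F p L H) := by
  have : PerfectRing F p := PerfectField.toPerfectRing p
  have : RingHomSurjective (frobenius F p) := ⟨(bijective_frobenius F p).2⟩
  have hcomm : ∀ a b : Enveloping F p H, a * b = b * a := fun a b =>
    e.symm.injective (by rw [map_mul, map_mul]; exact (Enveloping.commRing F p L).mul_comm _ _)
  have : IsLieAbelian H := ⟨fun x y => lie_eq_zero_of_comm hcomm x y⟩
  -- Finite dimensionality of `H` is not given; it comes from the embedding of `H` in `u(H)`, which
  -- is isomorphic to `u(L)`.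
  have : Module.Finite F (Enveloping F p L) := Enveloping.finite
  have : Module.Finite F (Enveloping F p H) := Module.Finite.equiv e.toLinearEquiv
  have : Module.Finite F H := Module.Finite.of_injective
    (Enveloping.ι F p H : H →ₗ[F] Enveloping F p H) (ι_injective_of_comm hcomm)
  have hdim : ∀ i, Module.finrank F (imageSeq (pMapSemilinear F p L) i) =
      Module.finrank F (imageSeq (pMapSemilinear F p H) i) := fun i =>
    Nat.pow_right_injective (Fact.out : p.Prime).two_le (by
      have h1 := AlgEquiv.finrank_span_range_pow e (p ^ i)
      rwa [Enveloping.finrank_span_range_pow, Enveloping.finrank_span_range_pow] at h1)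
  obtain ⟨g, hg⟩ := exists_equiv_of_finrank_imageSeq (pMapSemilinear F p L)
    (pMapSemilinear F p H) hdim (h.imp_right fun ⟨k, _, hk⟩ => ⟨k, hk⟩)
  exact ⟨{ g with
    map_lie' := fun {x y} => by
      rw [trivial_lie_zero, trivial_lie_zero]
      exact map_zero g
    map_pMap := hg }⟩

theorem mainTheorem7 {F : Type*} [Field F] {p : ℕ} [Fact p.Prime] [CharP F p]
    {L : Type*} [LieRing L] [LieAlgebra F L] [RestrictedLieAlgebra F p L]
    [Module.Finite F L] [IsLieAbelian L]
    {H : Type*} [LieRing H] [LieAlgebra F H] [RestrictedLieAlgebra F p H]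
    (hiso : Nonempty
      (RestrictedLieAlgebra.Enveloping F p L ≃ₐ[F] RestrictedLieAlgebra.Enveloping F p H)) :
    (PerfectField F → RestrictedLieAlgebra.IsPNilpotent F p L →
      Nonempty (RestrictedLieAlgebra.Iso F p L H)) ∧
    (IsAlgClosed F → Nonempty (RestrictedLieAlgebra.Iso F p L H)) := by
  obtain ⟨e⟩ := hiso
  exact ⟨fun _ h => RestrictedLieAlgebra.nonempty_iso_of_enveloping_equiv e (Or.inr h),
    fun h => RestrictedLieAlgebra.nonempty_iso_of_enveloping_equiv e (Or.inl h)⟩
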